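/- For a set $E\subseteq\mathbb{R}$ and a function $f:E\to\mathbb{R}$, define the $f$-removed sets by $E_0=E$, $E_{\alpha+1}=$ the set of discontinuity points of $f\restriction_{E_\alpha}$ (in the relative topology of $E_\alpha$), and $E_\alpha=\bigcap_{\beta<\alpha}E_\beta$ for limit $\alpha$. A function $f:[0,1]\to\mathbb{R}$ is *solvable* if it is of Baire class one and, for every closed $K\subseteq[0,1]$, the set of discontinuity points of $f\restriction_K$ is closed. Let $J\subseteq\mathbb{R}$ be closed (for example $J=[0,1]$ or $J=\mathbb{R}$), and let $SV\subseteq C([0,1])$ be the set of differentiable functions $y:[0,1]\to J$ (one-sided derivatives at the endpoints) whose derivative $y'$ is bounded and solvable, where $C([0,1])$ is the Polish space of continuous functions $[0,1]\to\mathbb{R}$ with the uniform metric. For $y\in SV$ let $|y|_{SV}$ be the least ordinal $\alpha$ such that $E_\alpha=\emptyset$, where $\{E_\alpha\}$ is the sequence of $y'$-removed sets on $E=[0,1]$. Then $|y|_{SV}$ is well defined and $<\omega_1$ for every $y\in SV$, and $y\mapsto|y|_{SV}$ is a $\boldsymbol{\Pi}^1_1$ norm on $SV$: that is, $SV$ is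 a coanalytic subset of $C([0,1])$, and there are an analytic set $R\subseteq C([0,1])^2$ and a coanalytic set $Q\subseteq C([0,1])^2$ such that for all $x\in C([0,1])$ and $y\in SV$, $$\bigl(x\in SV \text{ and } |x|_{SV}\le|y|_{SV}\bigr)\iff (x,y)\in R\iff (x,y)\in Q .$$ -/

import Mathlib

open Set Filter Topology

/-- The set of discontinuity points of the restriction `f ↾ A`, where continuity is with respect
to the topology induced on `A`. -/
def discontinuitySet {X Y : Type*} [TopologicalSpace X] [TopologicalSpace Y]
    (f : X → Y) (A : Set X) : Set X :=
  {x | x ∈ A ∧ ¬ ContinuousWithinAt f A x}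

/-- The sequence of `f`-removed sets on `E`: `E₀ = E`, `E_{α+1}` is the set of discontinuity points
of `f ↾ E_α`, and `E_α = ⋂_{β < α} E_β` at limit ordinals. -/
noncomputable def removedSet {X Y : Type*} [TopologicalSpace X] [TopologicalSpace Y]
    (f : X → Y) (E : Set X) (α : Ordinal.{0}) : Set X :=
  Ordinal.limitRecOn α E (fun _ A => discontinuitySet f A)
    (fun o _ prev => ⋂ (β : Ordinal.{0}) (h : β < o), prev β h)

theorem removedSet_zero {X Y : Type*} [TopologicalSpace X] [TopologicalSpace Y]
    (f : X → Y) (E : Set X) : removedSet f E 0 = E := by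
  simp [removedSet]

theorem removedSet_succ {X Y : Type*} [TopologicalSpace X] [TopologicalSpace Y]
    (f : X → Y) (E : Set X) (α : Ordinal.{0}) :
    removedSet f E (Order.succ α) = discontinuitySet f (removedSet f E α) := by
  simp [removedSet]

theorem removedSet_limit {X Y : Type*} [TopologicalSpace X] [TopologicalSpace Y]
    (f : X → Y) (E : Set X) (α : Ordinal.{0}) (hα : Order.IsSuccLimit α) :
    removedSet f E α = ⋂ (β : Ordinal.{0}) (_ : β < α), removedSet f E β := by
  simp [removedSet, Ordinal.limitRecOn_limit _ _ _ _ hα]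

/-- `f` is of Baire class one on `E`: a pointwise limit of continuous functions on `E`. -/
def IsBaireOneOn {X Y : Type*} [TopologicalSpace X] [TopologicalSpace Y]
    (f : X → Y) (E : Set X) : Prop :=
  ∃ F : ℕ → X → Y, (∀ n, ContinuousOn (F n) E) ∧
    ∀ x ∈ E, Tendsto (fun n => F n x) atTop (𝓝 (f x))

/-- `f` is solvable on the compact set `E`: it is of Baire class one on `E`, and for every closed
`K ⊆ E` the set of discontinuity points of `f ↾ K` is closed. -/
def IsSolvableOn {X Y : Type*} [TopologicalSpace X] [TopologicalSpace Y]
    (f : X → Y) (E : Set X) : Prop :=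
  IsBaireOneOn f E ∧ ∀ K ⊆ E, IsClosed K → IsClosed (discontinuitySet f K)

/-- A continuous function on `[0,1]`, viewed as a function on `ℝ` (constant outside `[0,1]`; only
its values on `[0,1]` are ever used below). -/
noncomputable def extendToReal (y : C(unitInterval, ℝ)) : ℝ → ℝ :=
  Set.IccExtend (zero_le_one' ℝ) y

/-- The derivative `y'` on `[0,1]`, one-sided at the endpoints. -/
noncomputable def unitDeriv (y : C(unitInterval, ℝ)) : ℝ → ℝ :=
  derivWithin (extendToReal y) (Set.Icc 0 1)

/-- The class `SV` of differentiable functions `y : [0,1] → J` whose derivative is bounded and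
solvable, as a subset of `C([0,1])`. -/
def SV (J : Set ℝ) : Set C(unitInterval, ℝ) :=
  {y | (∀ t, y t ∈ J) ∧
    DifferentiableOn ℝ (extendToReal y) (Set.Icc 0 1) ∧
    (∃ C : ℝ, ∀ x ∈ Set.Icc (0 : ℝ) 1, |unitDeriv y x| ≤ C) ∧
    IsSolvableOn (unitDeriv y) (Set.Icc 0 1)}

/-- The solvable ranking `|y|_SV`: the least `α` such that the `α`-th `y'`-removed set on `[0,1]`
is empty. -/
noncomputable def solvableRank (y : C(unitInterval, ℝ)) : Ordinal.{0} :=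
  sInf {α : Ordinal.{0} | removedSet (unitDeriv y) (Set.Icc 0 1) α = ∅}

/-- Coanalytic (boldface `Π¹₁`) subsets of a Polish space: complements of analytic sets. -/
def IsCoanalytic {X : Type*} [TopologicalSpace X] [PolishSpace X] (P : Set X) : Prop :=
  MeasureTheory.AnalyticSet Pᶜ

/-- `φ` is a `Π¹₁` norm on the subset `P` of the Polish space `X`: `P` is coanalytic and there are
an analytic `R ⊆ X²` and a coanalytic `Q ⊆ X²` such that, whenever `y ∈ P`,
`(x ∈ P ∧ φ x ≤ φ y) ↔ R (x, y) ↔ Q (x, y)`. -/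
def IsPi11Norm {X : Type*} [TopologicalSpace X] [PolishSpace X]
    (P : Set X) (φ : P → Ordinal.{0}) : Prop :=
  IsCoanalytic P ∧
  ∃ R Q : Set (X × X), MeasureTheory.AnalyticSet R ∧ IsCoanalytic Q ∧
    ∀ (x y : X) (hy : y ∈ P),
      ((∃ hx : x ∈ P, φ ⟨x, hx⟩ ≤ φ ⟨y, hy⟩) ↔ (x, y) ∈ R) ∧
      ((∃ hx : x ∈ P, φ ⟨x, hx⟩ ≤ φ ⟨y, hy⟩) ↔ (x, y) ∈ Q)

/-!
For a differentiable `y` on `[0,1]`, solvability of `f = y'` is a very rigid condition. If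
discontinuity points `z n` of `f` converge to some `p ≠ z n` with `f (z n) → f p`, then the Darboux
property of `f` allows approximating each `z n` by points at which `f` is close, but not
convergent, to `f (z n)`; all these points together with `p` form a closed set on which `f` is
continuous at the limit `p` of discontinuity points. Hence `f` is solvable if and only if its jumps
are isolated in the graph of `f` (`HasIsolatedJumps`, `isSolvableOn_derivWithin_iff`). So the
discontinuity points of `f` form a countable closed set, from stage `1` on the removed sets are its
successive Cantor-Bendixson derivatives, and since nonempty perfect sets are uncountable the
process ends at a countable stage (`HasIsolatedJumps.exists_removedSet_eq_empty`). Clustering of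
jumps is an existential statement about real sequences, so `SV` is coanalytic (`isCoanalytic_SV`).

The comparison `|x| ≤ |y|` for `y ∈ SV` is certified by countably many data (`RankWitness`): a list
of tasks, each consisting of a basic open set `V`, a point `a` and a jump `b` of `y'`, which claim
that points of `V` have at most the rank of `b`, and that only `a` may attain it. Coherence
(`RankWitness.Coherent`) requires that, for every punctured neighbourhood of `b`, the set `V \ {a}`
is covered by sets on which `x` is continuously differentiable and by sets of tasks for jumps of
`y'` in that neighbourhood. As these jumps may be taken of smaller rank than `b`, induction on the
rank shows that the claims are true. The same induction shows that every point is a listed point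
or one near which `x` is continuously differentiable; thus the uncountable quantifier in
"`x` is differentiable" reduces to the countably many listed points, and `x ∈ SV` becomes a
consequence of the certificate (`RankWitness.Coherent.mem_SV`). Conversely the true claims form a
coherent witness (`RankWitness.exists_coherent`).

Coherence is a Borel condition, because coverage of compact sets only involves finite subcovers
and the derivatives occurring in it are part of the data. This makes `|x| ≤ |y|` analytic
(`RankWitness.le_iff_exists`), and also `|y| < |x|` for `x, y ∈ SV` (`RankWitness.lt_iff_exists`);
the complement of the latter within the coanalytic condition `x ∈ SV` is the coanalytic
description.
-/

/-! ### The removed sets -/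

theorem discontinuitySet_subset {X Y : Type*} [TopologicalSpace X] [TopologicalSpace Y]
    (f : X → Y) (A : Set X) : discontinuitySet f A ⊆ A := fun _ h => h.1

theorem discontinuitySet_mono {X Y : Type*} [TopologicalSpace X] [TopologicalSpace Y]
    (f : X → Y) {A B : Set X} (h : A ⊆ B) : discontinuitySet f A ⊆ discontinuitySet f B :=
  fun _ hx => ⟨h hx.1, fun hc => hx.2 (hc.mono h)⟩

theorem removedSet_antitone {X Y : Type*} [TopologicalSpace X] [TopologicalSpace Y]
    (f : X → Y) (E : Set X) : Antitone (removedSet f E) := by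
  intro α β
  induction β using Ordinal.limitRecOn with
  | zero => intro h; rw [nonpos_iff_eq_zero.1 h]
  | add_one β ih =>
    intro h
    rcases h.eq_or_lt with rfl | h
    · exact le_rfl
    · rw [← Order.succ_eq_add_one, removedSet_succ]
      exact (discontinuitySet_subset _ _).trans (ih (Order.lt_succ_iff.1 h))
  | limit β hβ _ =>
    intro h
    rcases h.eq_or_lt with rfl | h
    · exact le_rfl
    · rw [removedSet_limit _ _ _ hβ]
      exact iInter₂_subset α h

theorem removedSet_subset {X Y : Type*} [TopologicalSpace X] [TopologicalSpace Y]
    (f : X → Y) (E : Set X) (α : Ordinal.{0}) : removedSet f E α ⊆ E := by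
  simpa [removedSet_zero] using removedSet_antitone f E (zero_le (a := α))

theorem removedSet_one {X Y : Type*} [TopologicalSpace X] [TopologicalSpace Y]
    (f : X → Y) (E : Set X) : removedSet f E 1 = discontinuitySet f E := by
  rw [← zero_add (1 : Ordinal.{0}), ← Order.succ_eq_add_one, removedSet_succ, removedSet_zero]

theorem removedSet_subset_discontinuitySet {X Y : Type*} [TopologicalSpace X] [TopologicalSpace Y]
    (f : X → Y) (E : Set X) {α : Ordinal.{0}} (hα : 1 ≤ α) :
    removedSet f E α ⊆ discontinuitySet f E :=
  removedSet_one f E ▸ removedSet_antitone f E hα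

/-- A point of `E` that is eventually removed leaves at a successor stage. -/
theorem exists_mem_removedSet_notMem_succ {X Y : Type*} [TopologicalSpace X] [TopologicalSpace Y]
    {f : X → Y} {E : Set X} {t : X} (ht : t ∈ E) {α : Ordinal.{0}} (hα : t ∉ removedSet f E α) :
    ∃ γ < α, t ∈ removedSet f E γ ∧ t ∉ removedSet f E (Order.succ γ) := by
  induction α using Ordinal.limitRecOn with
  | zero => exact absurd ht (by simpa [removedSet_zero] using hα)
  | add_one β ih =>
    by_cases h : t ∈ removedSet f E β
    · exact ⟨β, Order.lt_succ β, h, hα⟩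
    · obtain ⟨γ, h1, h2⟩ := ih h
      exact ⟨γ, h1.trans (Order.lt_succ β), h2⟩
  | limit β hβ ih =>
    rw [removedSet_limit _ _ _ hβ] at hα
    simp only [mem_iInter, not_forall] at hα
    obtain ⟨δ, hδ, h⟩ := hα
    obtain ⟨γ, h1, h2⟩ := ih δ hδ h
    exact ⟨γ, h1.trans hδ, h2⟩

/-- Points that survive a removal step are accumulation points of the previous stage. -/
theorem exists_near_of_mem_removedSet_succ {f : ℝ → ℝ} {E : Set ℝ} {q : ℝ} {α : Ordinal.{0}}
    (hq : q ∈ removedSet f E (Order.succ α)) {δ : ℝ} (hδ : 0 < δ) :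
    ∃ t ∈ removedSet f E α, t ≠ q ∧ |t - q| < δ := by
  rw [removedSet_succ] at hq
  by_contra! h
  refine hq.2 (Metric.continuousWithinAt_iff.2 fun ε hε => ⟨δ, hδ, fun {t} ht htq => ?_⟩)
  by_cases hne : t = q
  · simpa [hne] using hε
  · exact absurd htq (not_lt.2 (h t ht hne))

/-- The discontinuity points of `f` on `E` are isolated in the graph of `f`: near each point `p`
of `E`, the values of `f` at other discontinuity points stay away from `f p`. -/
def HasIsolatedJumps (f : ℝ → ℝ) (E : Set ℝ) : Prop :=
  ∀ p ∈ E, ∃ ε > 0, ∀ z ∈ discontinuitySet f E, z ≠ p → |z - p| < ε → ε ≤ |f z - f p|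

theorem HasIsolatedJumps.isClosed_discontinuitySet {f : ℝ → ℝ} {E K : Set ℝ}
    (h : HasIsolatedJumps f E) (hKE : K ⊆ E) (hK : IsClosed K) :
    IsClosed (discontinuitySet f K) := by
  refine isClosed_of_closure_subset fun p hp => ?_
  have hpK : p ∈ K := hK.closure_subset_iff.2 (discontinuitySet_subset f K) hp
  refine ⟨hpK, fun hc => ?_⟩
  obtain ⟨ε, hε, H⟩ := h p (hKE hpK)
  obtain ⟨δ, hδ, hcδ⟩ := Metric.continuousWithinAt_iff.1 hc ε hε
  obtain ⟨z, hz, hzp⟩ := Metric.mem_closure_iff.1 hp (min ε δ) (lt_min hε hδ)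
  rw [dist_comm] at hzp
  have hne : z ≠ p := by
    rintro rfl
    exact hz.2 hc
  have h1 := H z (discontinuitySet_mono f hKE hz) hne (hzp.trans_le (min_le_left _ _))
  exact absurd (hcδ hz.1 (hzp.trans_le (min_le_right _ _))) (not_lt.2 h1)

theorem HasIsolatedJumps.isClosed_removedSet {f : ℝ → ℝ} {E : Set ℝ}
    (h : HasIsolatedJumps f E) (hE : IsClosed E) (α : Ordinal.{0}) :
    IsClosed (removedSet f E α) := by
  induction α using Ordinal.limitRecOn with
  | zero => rwa [removedSet_zero]
  | add_one β ih =>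
    rw [← Order.succ_eq_add_one, removedSet_succ]
    exact h.isClosed_discontinuitySet (removedSet_subset f E β) ih
  | limit β hβ ih =>
    rw [removedSet_limit _ _ _ hβ]
    exact isClosed_iInter fun γ => isClosed_iInter fun hγ => ih γ hγ

/-- From stage `1` on, the points removed from a stage are its isolated points. -/
theorem HasIsolatedJumps.eq_of_near {f : ℝ → ℝ} {E : Set ℝ}
    (h : HasIsolatedJumps f E) {α : Ordinal.{0}} (hα : 1 ≤ α) {q : ℝ}
    (hq : q ∈ removedSet f E α) (hq' : q ∉ removedSet f E (Order.succ α)) :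
    ∃ δ > 0, ∀ t ∈ removedSet f E α, |t - q| < δ → t = q := by
  have hc : ContinuousWithinAt f (removedSet f E α) q := by
    by_contra hc
    exact hq' (by rw [removedSet_succ]; exact ⟨hq, hc⟩)
  obtain ⟨ε, hε, H⟩ := h q (removedSet_subset f E α hq)
  obtain ⟨δ, hδ, hcδ⟩ := Metric.continuousWithinAt_iff.1 hc ε hε
  refine ⟨min ε δ, lt_min hε hδ, fun t ht htq => ?_⟩
  by_contra hne
  have h1 := H t (removedSet_subset_discontinuitySet f E hα ht) hne
    (htq.trans_le (min_le_left _ _))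
  exact absurd (hcδ ht (htq.trans_le (min_le_right _ _))) (not_lt.2 h1)

theorem HasIsolatedJumps.countable {f : ℝ → ℝ} {E : Set ℝ} (h : HasIsolatedJumps f E) :
    (discontinuitySet f E).Countable := by
  set D := discontinuitySet f E
  -- The graph of `f` over `D` is a discrete subset of the plane.
  set G : Set (ℝ × ℝ) := (fun z => (z, f z)) '' D
  have hdisc : IsDiscrete G := by
    rw [isDiscrete_iff_forall_mem_exists_isOpen]
    rintro _ ⟨p, hp, rfl⟩
    obtain ⟨ε, hε, H⟩ := h p hp.1
    refine ⟨Metric.ball (p, f p) ε, Metric.isOpen_ball, ?_⟩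
    refine subset_antisymm ?_ (by
      rintro _ rfl
      exact ⟨Metric.mem_ball_self hε, ⟨p, hp, rfl⟩⟩)
    rintro _ ⟨hz, ⟨z, hzD, rfl⟩⟩
    by_cases hne : z = p
    · rw [hne]; rfl
    · rw [Metric.mem_ball, Prod.dist_eq, max_lt_iff] at hz
      exact absurd hz.2 (not_lt.2 (H z hzD hne hz.1))
  have hc : G.Countable :=
    (HereditarilyLindelofSpace.isLindelof G).countable_of_isDiscrete hdisc
  exact (countable_of_injective_of_countable_image
    (fun a _ b _ hab => (Prod.ext_iff.1 hab).1) hc)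

/-- The removal process terminates at a countable stage: otherwise the points that survive all
countable stages would form a countable perfect set. -/
theorem HasIsolatedJumps.exists_removedSet_eq_empty {f : ℝ → ℝ} {E : Set ℝ}
    (h : HasIsolatedJumps f E) (hE : IsClosed E) :
    ∃ α : Ordinal.{0}, α < Ordinal.omega 1 ∧ removedSet f E α = ∅ := by
  classical
  have hunc : Uncountable (ℕ → Bool) := by
    rw [← Cardinal.aleph0_lt_mk_iff]
    simpa using Cardinal.cantor Cardinal.aleph0
  have hcount := h.countable
  have : Countable (discontinuitySet f E) := hcount.to_subtype
  let r : discontinuitySet f E → Ordinal.{0} := fun z =>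
    if hz : ∃ α : Ordinal.{0}, α < Ordinal.omega 1 ∧ z.1 ∉ removedSet f E α then hz.choose else 0
  have hω : Order.IsSuccLimit (Ordinal.omega.{0} 1) := Cardinal.isSuccLimit_omega 1
  have hr : ∀ z, r z < Ordinal.omega 1 := fun z => by
    by_cases hz : ∃ α : Ordinal.{0}, α < Ordinal.omega 1 ∧ z.1 ∉ removedSet f E α
    · simpa only [r, dif_pos hz] using hz.choose_spec.1
    · simpa only [r, dif_neg hz] using Ordinal.omega_pos 1
  set α := max 1 (iSup r)
  have hone : (1 : Ordinal.{0}) < Ordinal.omega 1 :=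
    Ordinal.one_lt_omega0.trans Ordinal.omega0_lt_omega_one
  have hαω : α < Ordinal.omega 1 := max_lt hone (Ordinal.iSup_lt_omega_one hr)
  refine ⟨α, hαω, ?_⟩
  have hstab : ∀ z ∈ removedSet f E α, z ∈ removedSet f E (Order.succ α) := by
    intro z hz
    by_contra hz'
    let z' : discontinuitySet f E :=
      ⟨z, removedSet_subset_discontinuitySet f E (le_max_left _ _) hz⟩
    have hex : ∃ α : Ordinal.{0}, α < Ordinal.omega 1 ∧ z'.1 ∉ removedSet f E α :=
      ⟨_, hω.succ_lt hαω, hz'⟩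
    have h1 : z ∉ removedSet f E (r z') := by
      simpa only [r, dif_pos hex] using hex.choose_spec.2
    exact h1 (removedSet_antitone f E
      ((Ordinal.le_iSup r z').trans (le_max_right _ _)) hz)
  by_contra hne
  have hperf : Perfect (removedSet f E α) := by
    refine ⟨h.isClosed_removedSet hE α, preperfect_iff_nhds.2 fun q hq U hU => ?_⟩
    obtain ⟨δ, hδ, hδU⟩ := Metric.mem_nhds_iff.1 hU
    obtain ⟨t, ht, htne, htq⟩ := exists_near_of_mem_removedSet_succ (hstab q hq) hδ
    exact ⟨t, ⟨hδU htq, ht⟩, htne⟩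
  obtain ⟨φ, hφ, -, hinj⟩ := hperf.exists_nat_bool_injection (nonempty_iff_ne_empty.2 hne)
  have hcr : (range φ).Countable :=
    (hcount.mono (removedSet_subset_discontinuitySet f E (le_max_left _ _))).mono hφ
  have : Countable (ℕ → Bool) :=
    countable_univ_iff.1 (((mapsTo_range φ univ).countable_of_injOn hinj.injOn hcr))
  exact not_countable this

/-! ### Solvable derivatives -/

/-- Failure of `HasIsolatedJumps` at `p` for a function with the Darboux property: `p` together
with suitable sequences converging to nearby discontinuity points is a closed set on which the
discontinuity points accumulate at the continuity point `p`. -/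
theorem hasIsolatedJumps_of_isClosed {f : ℝ → ℝ} {E : Set ℝ}
    (hord : E.OrdConnected) (hD : ∀ s ⊆ E, s.OrdConnected → (f '' s).OrdConnected)
    (h : ∀ K ⊆ E, IsClosed K → IsClosed (discontinuitySet f K)) :
    HasIsolatedJumps f E := by
  intro p hp
  by_contra! hcon
  -- Small closed sets near `p`, away from `p`, on which `f` is close to `f p` but discontinuous.
  have key : ∀ ε > 0, ∃ K ⊆ E, IsClosed K ∧ p ∉ K ∧ (∀ t ∈ K, |t - p| ≤ ε ∧ |f t - f p| ≤ ε) ∧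
      ∃ z ∈ discontinuitySet f K, |z - p| < ε := by
    intro ε hε
    obtain ⟨z, hz, hzp, hzε, hfε⟩ := hcon (ε / 2) (half_pos hε)
    have hnc := hz.2
    rw [Metric.continuousWithinAt_iff] at hnc
    push Not at hnc
    obtain ⟨η, hη, H⟩ := hnc
    have hzp' : 0 < |z - p| := abs_pos.2 (sub_ne_zero.2 hzp)
    set η' := min η (ε / 2)
    have hη' : 0 < η' := lt_min hη (half_pos hε)
    -- The Darboux property gives points near `z` where `f` differs from `f z` by exactly `η'`.
    have hseq : ∀ m : ℕ, ∃ t ∈ E, |t - z| < min (1 / ((m : ℝ) + 1)) (|z - p| / 2) ∧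
        |f t - f z| = η' := by
      intro m
      obtain ⟨t, htE, htz, hft⟩ := H (min (1 / ((m : ℝ) + 1)) (|z - p| / 2))
        (lt_min (by positivity) (by positivity))
      rw [Real.dist_eq] at htz hft
      have hsub : uIcc z t ⊆ E := hord.uIcc_subset hz.1 htE
      have hoc := hD (uIcc z t) hsub ordConnected_uIcc
      have hle : η' ≤ |f t - f z| := (min_le_left _ _).trans hft
      have hmem : (if f z ≤ f t then f z + η' else f z - η') ∈ f '' uIcc z t := by
        apply hoc.uIcc_subset (mem_image_of_mem f left_mem_uIcc)
          (mem_image_of_mem f right_mem_uIcc)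
        split_ifs with hzt
        · rw [abs_of_nonneg (sub_nonneg.2 hzt)] at hle
          exact mem_uIcc_of_le (by linarith) (by linarith)
        · rw [abs_of_neg (by linarith)] at hle
          exact mem_uIcc_of_ge (by linarith) (by linarith)
      obtain ⟨s, hs, hfs⟩ := hmem
      refine ⟨s, hsub hs, ?_, ?_⟩
      · exact (abs_sub_left_of_mem_uIcc hs).trans_lt htz
      · rw [hfs]
        split_ifs
        · rw [add_sub_cancel_left, abs_of_pos hη']
        · rw [sub_sub_cancel_left, abs_neg, abs_of_pos hη']
    choose t htE htz hft using hseq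
    have htend : Tendsto t atTop (𝓝 z) := by
      rw [tendsto_iff_dist_tendsto_zero]
      refine squeeze_zero (fun _ => dist_nonneg) (fun m => ?_)
        tendsto_one_div_add_atTop_nhds_zero_nat
      exact ((htz m).trans_le (min_le_left _ _)).le
    refine ⟨insert z (range t), ?_, htend.isCompact_insert_range.isClosed, ?_, ?_, z, ?_, ?_⟩
    · exact insert_subset hz.1 (range_subset_iff.2 htE)
    · rintro (hpz | ⟨m, hm⟩)
      · exact hzp hpz.symm
      · have := (htz m).trans_le (min_le_right _ _)
        rw [hm, abs_sub_comm] at this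
        linarith
    · rintro _ (rfl | ⟨m, rfl⟩)
      · exact ⟨by linarith, by linarith⟩
      · have h1 := (htz m).trans_le (min_le_right _ _)
        have h2 : |f (t m) - f z| ≤ ε / 2 := (hft m).trans_le (min_le_right _ _)
        constructor
        · have := abs_sub_le (t m) z p
          linarith
        · have := abs_sub_le (f (t m)) (f z) (f p)
          linarith
    · refine ⟨mem_insert _ _, fun hc => ?_⟩
      have h1 : Tendsto t atTop (𝓝[insert z (range t)] z) :=
        tendsto_nhdsWithin_iff.2 ⟨htend, .of_forall fun m => mem_insert_of_mem _ ⟨m, rfl⟩⟩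
      have h2 := (tendsto_iff_dist_tendsto_zero.1 (hc.tendsto.comp h1))
      simp only [Function.comp_apply, Real.dist_eq, hft] at h2
      exact hη'.ne' (tendsto_nhds_unique tendsto_const_nhds h2)
    · linarith
  choose K hKE hKcl hpK hKp hKd using fun n : ℕ => key (1 / ((n : ℝ) + 1)) (by positivity)
  set L : Set ℝ := insert p (⋃ n, K n)
  have hlim := tendsto_one_div_add_atTop_nhds_zero_nat (𝕜 := ℝ)
  have hLcl : IsClosed L := by
    refine isOpen_compl_iff.1 (isOpen_iff_mem_nhds.2 fun q hq => ?_)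
    have hqp : q ≠ p := fun h => hq (h ▸ mem_insert _ _)
    have hqK : ∀ n, q ∉ K n := fun n h => hq (mem_insert_of_mem _ (mem_iUnion.2 ⟨n, h⟩))
    have hd : 0 < |q - p| / 2 := by have := abs_pos.2 (sub_ne_zero.2 hqp); positivity
    obtain ⟨N, hN⟩ := eventually_atTop.1 (hlim.eventually (gt_mem_nhds hd))
    have hfin : (⋃ n ∈ Iio N, K n)ᶜ ∈ 𝓝 q :=
      ((finite_Iio N).isClosed_biUnion fun n _ => hKcl n).isOpen_compl.mem_nhds
        (by simpa using fun n _ => hqK n)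
    filter_upwards [hfin, Metric.ball_mem_nhds q hd] with t ht htq
    rw [Metric.mem_ball, Real.dist_eq] at htq
    have htri := abs_sub_le q t p
    rw [abs_sub_comm q t] at htri
    rintro (rfl | htK)
    · rw [abs_sub_comm] at htq; linarith
    · obtain ⟨n, hn⟩ := mem_iUnion.1 htK
      have hnN : N ≤ n := by
        by_contra hlt
        exact ht (mem_biUnion (mem_Iio.2 (not_le.1 hlt)) hn)
      have := (hKp n t hn).1
      have := hN n hnN
      linarith
  have hLE : L ⊆ E := insert_subset hp (iUnion_subset hKE)
  have hpL : p ∈ discontinuitySet f L := by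
    refine (h L hLE hLcl).closure_subset (Metric.mem_closure_iff.2 fun ε hε => ?_)
    obtain ⟨n, hn⟩ := (hlim.eventually (gt_mem_nhds hε)).exists
    obtain ⟨z, hz, hzp⟩ := hKd n
    refine ⟨z, discontinuitySet_mono f
      ((subset_iUnion K n).trans (subset_insert _ _)) hz, ?_⟩
    rw [dist_comm, Real.dist_eq]
    linarith
  refine hpL.2 (Metric.continuousWithinAt_iff'.2 fun ε hε => ?_)
  obtain ⟨N, hN⟩ := eventually_atTop.1 (hlim.eventually (gt_mem_nhds hε))
  have hfin : (⋃ n ∈ Iio N, K n)ᶜ ∈ 𝓝 p :=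
    ((finite_Iio N).isClosed_biUnion fun n _ => hKcl n).isOpen_compl.mem_nhds
      (by simpa using fun n _ => hpK n)
  filter_upwards [mem_nhdsWithin_of_mem_nhds hfin, self_mem_nhdsWithin] with t ht htL
  rcases htL with rfl | htK
  · simpa using hε
  · obtain ⟨n, hn⟩ := mem_iUnion.1 htK
    have hnN : N ≤ n := by
      by_contra hlt
      exact ht (mem_biUnion (mem_Iio.2 (not_le.1 hlt)) hn)
    exact ((hKp n t hn).2).trans_lt (hN n hnN)

/-- The derivative of a differentiable function on `[0,1]` is of Baire class one. -/
theorem isBaireOneOn_derivWithin {F : ℝ → ℝ} (hF : DifferentiableOn ℝ F (Icc 0 1)) :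
    IsBaireOneOn (derivWithin F (Icc 0 1)) (Icc 0 1) := by
  -- The slopes over the intervals `[x - 1 / (n + 1), x + 1 / (n + 1)] ∩ [0, 1]`.
  let a : ℕ → ℝ → ℝ := fun n x => max (x - 1 / ((n : ℝ) + 1)) 0
  let b : ℕ → ℝ → ℝ := fun n x => min (x + 1 / ((n : ℝ) + 1)) 1
  have ha : ∀ n, ∀ x ∈ Icc (0 : ℝ) 1, a n x ∈ Icc (0 : ℝ) 1 ∧
      a n x ≤ x ∧ x - a n x ≤ 1 / (n + 1) := by
    intro n x hx
    have hn : (0 : ℝ) < 1 / ((n : ℝ) + 1) := by positivity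
    have h1 : a n x ≤ x := max_le (by linarith) hx.1
    exact ⟨⟨le_max_right _ _, h1.trans hx.2⟩, h1, by
      linarith [le_max_left (x - 1 / ((n : ℝ) + 1)) 0]⟩
  have hb : ∀ n, ∀ x ∈ Icc (0 : ℝ) 1, b n x ∈ Icc (0 : ℝ) 1 ∧
      x ≤ b n x ∧ b n x - x ≤ 1 / (n + 1) := by
    intro n x hx
    have hn : (0 : ℝ) < 1 / ((n : ℝ) + 1) := by positivity
    have h1 : x ≤ b n x := le_min (by linarith) hx.2
    exact ⟨⟨hx.1.trans h1, min_le_right _ _⟩, h1, by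
      linarith [min_le_left (x + 1 / ((n : ℝ) + 1)) 1]⟩
  have hab : ∀ n, ∀ x ∈ Icc (0 : ℝ) 1, a n x < b n x := by
    intro n x hx
    have hn : (0 : ℝ) < 1 / ((n : ℝ) + 1) := by positivity
    refine max_lt (lt_min (by linarith) (by linarith [hx.2])) (lt_min (by linarith [hx.1]) one_pos)
  have hcont : ∀ n, Continuous (a n) ∧ Continuous (b n) := fun n =>
    ⟨by fun_prop, by fun_prop⟩
  refine ⟨fun n x => (F (b n x) - F (a n x)) / (b n x - a n x), fun n => ?_, fun x hx => ?_⟩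
  · refine ContinuousOn.div ?_ ((hcont n).2.sub (hcont n).1).continuousOn
      fun x hx => (sub_pos.2 (hab n x hx)).ne'
    exact (hF.continuousOn.comp (hcont n).2.continuousOn fun x hx => (hb n x hx).1).sub
      (hF.continuousOn.comp (hcont n).1.continuousOn fun x hx => (ha n x hx).1)
  · have hd := (hF x hx).hasDerivWithinAt
    rw [hasDerivWithinAt_iff_isLittleO, Asymptotics.isLittleO_iff] at hd
    rw [Metric.tendsto_atTop']
    intro ε hε
    obtain ⟨δ, hδ, H⟩ := Metric.mem_nhdsWithin_iff.1 (hd (half_pos hε))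
    obtain ⟨N, hN⟩ := eventually_atTop.1
      ((tendsto_one_div_add_atTop_nhds_zero_nat (𝕜 := ℝ)).eventually (gt_mem_nhds hδ))
    refine ⟨N, fun n hn => ?_⟩
    obtain ⟨ha1, ha2, ha3⟩ := ha n x hx
    obtain ⟨hb1, hb2, hb3⟩ := hb n x hx
    have hlt := hab n x hx
    have hn' := hN n hn.le
    have hA := H ⟨show a n x ∈ Metric.ball x δ by
      rw [Metric.mem_ball, Real.dist_eq, abs_sub_comm, abs_of_nonneg (by linarith)]; linarith, ha1⟩
    have hB := H ⟨show b n x ∈ Metric.ball x δ by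
      rw [Metric.mem_ball, Real.dist_eq, abs_of_nonneg (by linarith)]; linarith, hb1⟩
    simp only [mem_ofPred_eq, Real.norm_eq_abs, smul_eq_mul] at hA hB
    rw [abs_of_nonpos (by linarith : a n x - x ≤ 0)] at hA
    rw [abs_of_nonneg (by linarith : 0 ≤ b n x - x)] at hB
    have hpos : 0 < b n x - a n x := sub_pos.2 hlt
    rw [Real.dist_eq, div_sub' hpos.ne', abs_div, abs_of_pos hpos, div_lt_iff₀ hpos]
    rw [abs_le] at hA hB
    refine (abs_le.2 ⟨?_, ?_⟩ : _ ≤ ε / 2 * (b n x - a n x)).trans_lt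
      (mul_lt_mul_of_pos_right (half_lt_self hε) hpos) <;> nlinarith [hA.1, hA.2, hB.1, hB.2]

/-- For differentiable functions on `[0,1]`, solvability of the derivative means that its jumps
are isolated. -/
theorem isSolvableOn_derivWithin_iff {F : ℝ → ℝ} (hF : DifferentiableOn ℝ F (Icc 0 1)) :
    IsSolvableOn (derivWithin F (Icc 0 1)) (Icc 0 1) ↔
      HasIsolatedJumps (derivWithin F (Icc 0 1)) (Icc 0 1) := by
  refine ⟨fun h => hasIsolatedJumps_of_isClosed ordConnected_Icc
    (fun s hs hs' => ?_) h.2, fun h => ⟨isBaireOneOn_derivWithin hF,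
      fun K hK hKc => h.isClosed_discontinuitySet hK hKc⟩⟩
  exact hs'.image_hasDerivWithinAt fun x hx => ((hF x (hs hx)).hasDerivWithinAt).mono hs

/-! ### Derivatives on `[0,1]` through inequalities between increments -/

/-- `c` is a point of `[0,1]` at which `y` has the (one-sided at the endpoints) derivative `v`. -/
def HasUnitDeriv (y : C(unitInterval, ℝ)) (c v : ℝ) : Prop :=
  c ∈ Icc (0 : ℝ) 1 ∧ HasDerivWithinAt (extendToReal y) v (Icc 0 1) c

/-- `y` has the strict derivative `v` at `c`, relative to `[0,1]`. For differentiable `y` this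
expresses, without mentioning `y'`, that `y'` is continuous at `c` with value `v`. -/
def HasStrictUnitDeriv (y : C(unitInterval, ℝ)) (c v : ℝ) : Prop :=
  ∀ k : ℕ, ∃ l : ℕ, ∀ s ∈ Icc (0 : ℝ) 1, ∀ t ∈ Icc (0 : ℝ) 1,
    |s - c| < 1 / ((l : ℝ) + 1) → |t - c| < 1 / ((l : ℝ) + 1) →
      |extendToReal y s - extendToReal y t - v * (s - t)| ≤ 1 / ((k : ℝ) + 1) * |s - t|

/-- On `U ∩ [0,1]`, the difference quotients of `y` converge uniformly to the continuous
function `g`. -/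
def HasUniformDerivOn (y g : C(unitInterval, ℝ)) (U : Set ℝ) : Prop :=
  ∀ k : ℕ, ∃ l : ℕ, ∀ s ∈ Icc (0 : ℝ) 1, ∀ t ∈ Icc (0 : ℝ) 1, s ∈ U → t ∈ U →
    |s - t| < 1 / ((l : ℝ) + 1) →
      |extendToReal y s - extendToReal y t - extendToReal g t * (s - t)|
        ≤ 1 / ((k : ℝ) + 1) * |s - t|

theorem continuous_extendToReal (y : C(unitInterval, ℝ)) : Continuous (extendToReal y) :=
  y.continuous.Icc_extend'

theorem extendToReal_of_mem (y : C(unitInterval, ℝ)) {t : ℝ} (ht : t ∈ Icc (0 : ℝ) 1) :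
    extendToReal y t = y ⟨t, ht⟩ :=
  IccExtend_of_mem _ _ ht

theorem HasUnitDeriv.unitDeriv_eq {y : C(unitInterval, ℝ)} {c v : ℝ} (h : HasUnitDeriv y c v) :
    unitDeriv y c = v :=
  h.2.derivWithin (uniqueDiffOn_Icc_zero_one c h.1)

theorem hasUnitDeriv_unitDeriv {y : C(unitInterval, ℝ)} {c : ℝ} (hc : c ∈ Icc (0 : ℝ) 1)
    (h : DifferentiableWithinAt ℝ (extendToReal y) (Icc 0 1) c) :
    HasUnitDeriv y c (unitDeriv y c) :=
  ⟨hc, h.hasDerivWithinAt⟩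

/-- A derivative is bounded by a bound for the nearby increments. -/
theorem HasUnitDeriv.abs_sub_le {y : C(unitInterval, ℝ)} {c w v C : ℝ} (h : HasUnitDeriv y c w)
    (hC : ∀ᶠ s in 𝓝[Icc 0 1] c,
      |extendToReal y s - extendToReal y c - v * (s - c)| ≤ C * |s - c|) :
    |w - v| ≤ C := by
  have hne : (𝓝[Icc (0 : ℝ) 1 \ {c}] c).NeBot :=
    accPt_principal_iff_nhdsWithin.1 ((uniqueDiffOn_Icc_zero_one c h.1).accPt)
  have ht := (hasDerivWithinAt_iff_tendsto_slope.1 h.2)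
  refine le_of_tendsto ((ht.sub_const v).abs) ?_
  filter_upwards [hC.filter_mono (nhdsWithin_mono c sdiff_subset), self_mem_nhdsWithin] with s hs hsc
  have hsc' : s - c ≠ 0 := sub_ne_zero.2 hsc.2
  rw [slope_def_field, div_sub' hsc', abs_div, div_le_iff₀ (abs_pos.2 hsc'), mul_comm (s - c)]
  exact hs

/-- Mean value inequality for the increments of `y`. -/
theorem abs_increment_sub_le {y : C(unitInterval, ℝ)}
    (hy : DifferentiableOn ℝ (extendToReal y) (Icc 0 1)) {s t v ε : ℝ}
    (hs : s ∈ Icc (0 : ℝ) 1) (ht : t ∈ Icc (0 : ℝ) 1)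
    (h : ∀ ξ ∈ uIcc s t, |unitDeriv y ξ - v| ≤ ε) :
    |extendToReal y s - extendToReal y t - v * (s - t)| ≤ ε * |s - t| := by
  have hsub : uIcc s t ⊆ Icc (0 : ℝ) 1 := ordConnected_Icc.uIcc_subset hs ht
  have := (convex_uIcc s t).norm_image_sub_le_of_norm_hasDerivWithin_le
    (f := fun ξ => extendToReal y ξ - v * ξ) (f' := fun ξ => unitDeriv y ξ - v) (C := ε)
    (fun ξ hξ => by
      have h1 := ((hy ξ (hsub hξ)).hasDerivWithinAt).mono hsub
      simpa [unitDeriv] using h1.fun_sub ((hasDerivWithinAt_id ξ _).const_mul v))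
    h right_mem_uIcc left_mem_uIcc
  rw [Real.norm_eq_abs, Real.norm_eq_abs] at this
  convert this using 2
  ring

theorem hasStrictUnitDeriv_iff {y : C(unitInterval, ℝ)}
    (hy : DifferentiableOn ℝ (extendToReal y) (Icc 0 1)) {c : ℝ} :
    HasStrictUnitDeriv y c (unitDeriv y c) ↔ ContinuousWithinAt (unitDeriv y) (Icc 0 1) c := by
  rw [Metric.continuousWithinAt_iff]
  constructor
  · intro h ε hε
    obtain ⟨k, hk⟩ := exists_nat_one_div_lt hε
    obtain ⟨l, hl⟩ := h k
    refine ⟨1 / ((l : ℝ) + 1), by positivity, fun {z} hz hzc => ?_⟩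
    rw [Real.dist_eq] at hzc ⊢
    refine lt_of_le_of_lt ?_ hk
    refine (hasUnitDeriv_unitDeriv hz (hy z hz)).abs_sub_le ?_
    have hO : IsOpen {s : ℝ | |s - c| < 1 / ((l : ℝ) + 1)} :=
      isOpen_lt (by fun_prop) continuous_const
    filter_upwards [self_mem_nhdsWithin, mem_nhdsWithin_of_mem_nhds (hO.mem_nhds hzc)] with s hs hsc
    exact hl s hs z hz hsc hzc
  · intro h k
    obtain ⟨δ, hδ, H⟩ := h (1 / ((k : ℝ) + 1)) (by positivity)
    obtain ⟨l, hl⟩ := exists_nat_one_div_lt hδ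
    refine ⟨l, fun s hs t ht hsc htc => abs_increment_sub_le hy hs ht fun ξ hξ => ?_⟩
    have hball : uIcc s t ⊆ Metric.ball c δ := by
      rw [Real.ball_eq_Ioo]
      refine ordConnected_Ioo.uIcc_subset ?_ ?_ <;> rw [← Real.ball_eq_Ioo, Metric.mem_ball,
        Real.dist_eq] <;> linarith
    exact (H (ordConnected_Icc.uIcc_subset hs ht hξ) (hball hξ)).le

theorem mem_discontinuitySet_iff {y : C(unitInterval, ℝ)}
    (hy : DifferentiableOn ℝ (extendToReal y) (Icc 0 1)) {c v : ℝ} (h : HasUnitDeriv y c v) :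
    c ∈ discontinuitySet (unitDeriv y) (Icc 0 1) ↔ ¬ HasStrictUnitDeriv y c v := by
  rw [← h.unitDeriv_eq, hasStrictUnitDeriv_iff hy]
  exact ⟨fun h => h.2, fun h' => ⟨h.1, h'⟩⟩

theorem HasUniformDerivOn.hasUnitDeriv {y g : C(unitInterval, ℝ)} {U : Set ℝ} (hU : IsOpen U)
    (h : HasUniformDerivOn y g U) {t : ℝ} (ht : t ∈ Icc (0 : ℝ) 1) (htU : t ∈ U) :
    HasUnitDeriv y t (extendToReal g t) := by
  refine ⟨ht, ?_⟩
  rw [hasDerivWithinAt_iff_isLittleO, Asymptotics.isLittleO_iff]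
  intro ε hε
  obtain ⟨k, hk⟩ := exists_nat_one_div_lt hε
  obtain ⟨l, hl⟩ := h k
  have hO : IsOpen {s : ℝ | |s - t| < 1 / ((l : ℝ) + 1)} :=
    isOpen_lt (by fun_prop) continuous_const
  have htO : t ∈ {s : ℝ | |s - t| < 1 / ((l : ℝ) + 1)} := by
    simp only [mem_ofPred_eq, sub_self, abs_zero]; positivity
  filter_upwards [self_mem_nhdsWithin, mem_nhdsWithin_of_mem_nhds (hO.mem_nhds htO),
    mem_nhdsWithin_of_mem_nhds (hU.mem_nhds htU)] with s hs hst hsU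
  rw [Real.norm_eq_abs, Real.norm_eq_abs, smul_eq_mul, mul_comm (s - t)]
  exact (hl s hs t ht hsU htU hst).trans (mul_le_mul_of_nonneg_right hk.le (abs_nonneg _))

theorem HasUniformDerivOn.notMem_discontinuitySet {y g : C(unitInterval, ℝ)} {U : Set ℝ}
    (hU : IsOpen U) (h : HasUniformDerivOn y g U) {t : ℝ} (htU : t ∈ U) :
    t ∉ discontinuitySet (unitDeriv y) (Icc 0 1) := by
  rintro ⟨ht, hnc⟩
  refine hnc ((continuous_extendToReal g).continuousWithinAt.congr_of_eventuallyEq ?_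
    (h.hasUnitDeriv hU ht htU).unitDeriv_eq)
  filter_upwards [self_mem_nhdsWithin, mem_nhdsWithin_of_mem_nhds (hU.mem_nhds htU)] with s hs hsU
  exact (h.hasUnitDeriv hU hs hsU).unitDeriv_eq

/-- Off the closure of the discontinuity points of `y'`, the difference quotients converge
locally uniformly. -/
theorem exists_hasUniformDerivOn {y : C(unitInterval, ℝ)}
    (hy : DifferentiableOn ℝ (extendToReal y) (Icc 0 1))
    (hD : IsClosed (discontinuitySet (unitDeriv y) (Icc 0 1))) {t : ℝ}
    (ht : t ∉ discontinuitySet (unitDeriv y) (Icc 0 1)) :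
    ∃ δ > 0, ∃ g, HasUniformDerivOn y g (Metric.ball t δ) := by
  obtain ⟨δ, hδ, hball⟩ := Metric.mem_nhds_iff.1 (hD.isOpen_compl.mem_nhds ht)
  have hsub : Icc (t - δ / 2) (t + δ / 2) ⊆ Metric.ball t δ := by
    rw [Real.ball_eq_Ioo]
    exact Icc_subset_Ioo (by linarith) (by linarith)
  set A := Icc (t - δ / 2) (t + δ / 2) ∩ Icc (0 : ℝ) 1
  have hAcl : IsClosed A := isClosed_Icc.inter isClosed_Icc
  have hAc : IsCompact A := isCompact_Icc.inter_right isClosed_Icc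
  have hcont : ContinuousOn (unitDeriv y) A := by
    intro s hs
    have h1 : ¬ s ∈ discontinuitySet (unitDeriv y) (Icc 0 1) := hball (hsub hs.1)
    exact (not_not.1 fun h => h1 ⟨hs.2, h⟩ : ContinuousWithinAt _ _ _).mono inter_subset_right
  -- A continuous extension of `y'` from the compact set `A`.
  obtain ⟨G, hG⟩ := ContinuousMap.exists_restrict_eq hAcl ⟨A.domRestrict (unitDeriv y), hcont.domRestrict⟩
  have hGA : ∀ s ∈ A, G s = unitDeriv y s := fun s hs => DFunLike.congr_fun hG ⟨s, hs⟩
  refine ⟨δ / 2, half_pos hδ, ⟨fun s => G s, by fun_prop⟩, fun k => ?_⟩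
  obtain ⟨η, hη, H⟩ := Metric.uniformContinuousOn_iff.1
    (hAc.uniformContinuousOn_of_continuous hcont) (1 / ((k : ℝ) + 1)) (by positivity)
  obtain ⟨l, hl⟩ := exists_nat_one_div_lt hη
  refine ⟨l, fun s hs r hr hsU hrU hsr => ?_⟩
  rw [Real.ball_eq_Ioo] at hsU hrU
  have hrA : r ∈ A := ⟨Ioo_subset_Icc_self hrU, hr⟩
  have hsA : s ∈ A := ⟨Ioo_subset_Icc_self hsU, hs⟩
  rw [extendToReal_of_mem ⟨fun s : unitInterval => G s, by fun_prop⟩ hr,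
    ContinuousMap.coe_mk, hGA r hrA]
  refine abs_increment_sub_le hy hs hr fun ξ hξ => ?_
  have hξA : ξ ∈ A := (ordConnected_Icc.inter ordConnected_Icc).uIcc_subset hsA hrA hξ
  refine (H ξ hξA r hrA ?_).le
  rw [Real.dist_eq, abs_sub_comm]
  refine (abs_sub_right_of_mem_uIcc hξ).trans_lt ?_
  rw [abs_sub_comm]
  linarith

/-! ### The class `SV` -/

/-- Membership in `SV` in terms of increments and of isolated jumps of the derivative. -/
theorem mem_SV_iff {J : Set ℝ} {y : C(unitInterval, ℝ)} :
    y ∈ SV J ↔ (∀ t, y t ∈ J) ∧ DifferentiableOn ℝ (extendToReal y) (Icc 0 1) ∧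
      (∃ C : ℕ, ∀ s t, |y s - y t| ≤ C * |(s : ℝ) - t|) ∧
      HasIsolatedJumps (unitDeriv y) (Icc 0 1) := by
  refine and_congr_right fun _ => and_congr_right fun hy => and_congr ⟨?_, ?_⟩
    (isSolvableOn_derivWithin_iff hy)
  · rintro ⟨C, hC⟩
    obtain ⟨N, hN⟩ := exists_nat_ge C
    refine ⟨N, fun s t => ?_⟩
    have := abs_increment_sub_le hy (v := 0) (ε := N) s.2 t.2 fun ξ hξ => by
      rw [sub_zero]
      exact (hC ξ (ordConnected_Icc.uIcc_subset s.2 t.2 hξ)).trans hN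
    simpa [extendToReal_of_mem, s.2, t.2] using this
  · rintro ⟨C, hC⟩
    refine ⟨C, fun x hx => ?_⟩
    rw [← sub_zero (unitDeriv y x)]
    refine (hasUnitDeriv_unitDeriv hx (hy x hx)).abs_sub_le ?_
    filter_upwards [self_mem_nhdsWithin] with s hs
    simpa [extendToReal_of_mem, hs, hx] using hC ⟨s, hs⟩ ⟨x, hx⟩

theorem exists_removedSet_eq_empty_of_mem_SV {J : Set ℝ} {y : C(unitInterval, ℝ)}
    (hy : y ∈ SV J) :
    ∃ α : Ordinal.{0}, α < Ordinal.omega 1 ∧ removedSet (unitDeriv y) (Icc 0 1) α = ∅ :=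
  (mem_SV_iff.1 hy).2.2.2.exists_removedSet_eq_empty isClosed_Icc

theorem one_le_of_removedSet_eq_empty {y : C(unitInterval, ℝ)} {α : Ordinal.{0}}
    (h : removedSet (unitDeriv y) (Icc 0 1) α = ∅) : 1 ≤ α := by
  rw [Order.one_le_iff_pos, pos_iff_ne_zero]
  rintro rfl
  rw [removedSet_zero] at h
  exact (nonempty_Icc.2 zero_le_one).ne_empty h

theorem solvableRank_le_iff {J : Set ℝ} {y : C(unitInterval, ℝ)} (hy : y ∈ SV J)
    {α : Ordinal.{0}} :
    solvableRank y ≤ α ↔ removedSet (unitDeriv y) (Icc 0 1) α = ∅ := by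
  obtain ⟨β, -, hβ⟩ := exists_removedSet_eq_empty_of_mem_SV hy
  refine ⟨fun h => ?_, fun h => csInf_le' h⟩
  have h1 : removedSet (unitDeriv y) (Icc 0 1) (solvableRank y) = ∅ := csInf_mem (s :=
    {α : Ordinal.{0} | removedSet (unitDeriv y) (Icc 0 1) α = ∅}) ⟨β, hβ⟩
  exact subset_empty_iff.1 (h1 ▸ removedSet_antitone _ _ h)

/-! ### Witnesses for the comparison of ranks -/

/-- The data of a comparison of the ranks of `x` and `y`: a ternary relation on indices, source
points with the derivatives of `x` there, target points with the derivatives of `y` there, and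
continuous functions serving as local derivatives of `x`. -/
abbrev RankWitness : Type :=
  (ℕ × ℕ × ℕ → Bool) × (ℕ → ℝ) × (ℕ → ℝ) × (ℕ → ℝ) × (ℕ → ℝ) × (ℕ → C(unitInterval, ℝ))

namespace RankWitness

/-- `w.Task i n m` claims that the points of the `i`-th basic open set have at most the rank of
the `m`-th target point, and that only the `n`-th source point may attain it. -/
def Task (w : RankWitness) (i n m : ℕ) : Prop := w.1 (i, n, m) = true

/-- The source points: points of `[0,1]` at which `x` is examined. -/
def src (w : RankWitness) (n : ℕ) : ℝ := w.2.1 n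

/-- The derivatives of `x` at the source points. -/
def srcDeriv (w : RankWitness) (n : ℕ) : ℝ := w.2.2.1 n

/-- The target points: discontinuity points of `y'`. -/
def tgt (w : RankWitness) (m : ℕ) : ℝ := w.2.2.2.1 m

/-- The derivatives of `y` at the target points. -/
def tgtDeriv (w : RankWitness) (m : ℕ) : ℝ := w.2.2.2.2.1 m

/-- Candidates for the derivative of `x` on the basic open sets. -/
def localDeriv (w : RankWitness) (j : ℕ) : C(unitInterval, ℝ) := w.2.2.2.2.2 j

/-- The union of the basic open sets `U j` on which `x` is continuously differentiable or which
`w` compares with a target point in `T`. -/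
def region (U : ℕ → Set ℝ) (x : C(unitInterval, ℝ)) (w : RankWitness) (T : Set ℝ) : Set ℝ :=
  {z | ∃ j, z ∈ U j ∧
    (HasUniformDerivOn x (w.localDeriv j) (U j) ∨ ∃ n m, w.Task j n m ∧ w.tgt m ∈ T)}

/-- The punctured neighbourhood of `q` of radius `1 / (k + 1)`. -/
def punctured (q : ℝ) (k : ℕ) : Set ℝ := {r | r ≠ q ∧ |r - q| < 1 / ((k : ℝ) + 1)}

/-- The data `w` is coherent. The essential condition is `cover`: apart from the source point, the
basic open set of a task is covered by sets on which `x` is continuously differentiable and by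
sets of tasks whose target points accumulate at the target point of the given task, hence have
smaller rank. -/
structure Coherent (U : ℕ → Set ℝ) (x y : C(unitInterval, ℝ)) (w : RankWitness) : Prop where
  target : ∀ i n m, w.Task i n m →
    HasUnitDeriv y (w.tgt m) (w.tgtDeriv m) ∧ ¬ HasStrictUnitDeriv y (w.tgt m) (w.tgtDeriv m)
  source : ∀ i n m, w.Task i n m → HasUnitDeriv x (w.src n) (w.srcDeriv n)
  isolated : ∀ i n m, w.Task i n m → ∃ l : ℕ, ∀ i' n' m', w.Task i' n' m' →
    w.src n' ≠ w.src n → |w.src n' - w.src n| < 1 / ((l : ℝ) + 1) →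
      1 / ((l : ℝ) + 1) ≤ |w.srcDeriv n' - w.srcDeriv n|
  cover : ∀ i n m, w.Task i n m → ∀ k,
    (Icc 0 1 ∩ U i) \ {w.src n} ⊆ region U x w (punctured (w.tgt m) k)

/-! ### Coherent witnesses bound ranks -/

variable {U : ℕ → Set ℝ} {x y : C(unitInterval, ℝ)} {w : RankWitness}

/-- A discontinuity point of `y'` that is removed before stage `α` is removed right after a stage
`β < α` in which it is isolated. -/
theorem exists_stage (hyj : HasIsolatedJumps (unitDeriv y) (Icc 0 1)) {q : ℝ}
    (hq : q ∈ discontinuitySet (unitDeriv y) (Icc 0 1)) {α : Ordinal.{0}}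
    (hα : q ∉ removedSet (unitDeriv y) (Icc 0 1) α) :
    ∃ β < α, 1 ≤ β ∧ q ∈ removedSet (unitDeriv y) (Icc 0 1) β ∧
      ∃ k, ∀ r ∈ punctured q k, r ∉ removedSet (unitDeriv y) (Icc 0 1) β := by
  obtain ⟨β, hβα, hβ, hβ'⟩ := exists_mem_removedSet_notMem_succ hq.1 hα
  have h1 : 1 ≤ β := by
    rw [Order.one_le_iff_pos, pos_iff_ne_zero]
    rintro rfl
    rw [removedSet_succ, removedSet_zero] at hβ'
    exact hβ' hq
  obtain ⟨δ, hδ, H⟩ := hyj.eq_of_near h1 hβ hβ'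
  obtain ⟨k, hk⟩ := exists_nat_one_div_lt hδ
  exact ⟨β, hβα, h1, hβ, k, fun r hr hr' => hr.1 (H r hr' (hr.2.trans hk))⟩

/-- Coherence forces each point of the set of a task to be a source point or a point near which
`x` is continuously differentiable: covering sets are passed on to targets of smaller rank, and
this has to end. -/
theorem Coherent.isSource_or_hasUniformDerivOn (hw : w.Coherent U x y)
    (hyd : DifferentiableOn ℝ (extendToReal y) (Icc 0 1))
    (hyj : HasIsolatedJumps (unitDeriv y) (Icc 0 1)) (α : Ordinal.{0}) :
    ∀ i n m, w.Task i n m → w.tgt m ∉ removedSet (unitDeriv y) (Icc 0 1) α →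
      ∀ t ∈ Icc (0 : ℝ) 1, t ∈ U i →
        (∃ i' n' m', w.Task i' n' m' ∧ w.src n' = t) ∨
          ∃ j, t ∈ U j ∧ HasUniformDerivOn x (w.localDeriv j) (U j) := by
  induction α using WellFoundedLT.induction with
  | ind α ih =>
  intro i n m ht hα t ht01 htU
  by_cases htn : t = w.src n
  · exact .inl ⟨i, n, m, ht, htn.symm⟩
  · have hq := (mem_discontinuitySet_iff hyd (hw.target i n m ht).1).2 (hw.target i n m ht).2
    obtain ⟨β, hβα, -, -, k, hk⟩ := exists_stage hyj hq hα
    obtain ⟨j, htj, hj | ⟨n', m', ht', hm'⟩⟩ := hw.cover i n m ht k ⟨⟨ht01, htU⟩, htn⟩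
    · exact .inr ⟨j, htj, hj⟩
    · exact ih β hβα j n' m' ht' (hk _ hm') t ht01 htj

/-- Coherence bounds ranks: the set of a task is exhausted no later than its target point. -/
theorem Coherent.notMem_removedSet (hw : w.Coherent U x y) (hU : ∀ j, IsOpen (U j))
    (hyd : DifferentiableOn ℝ (extendToReal y) (Icc 0 1))
    (hyj : HasIsolatedJumps (unitDeriv y) (Icc 0 1)) (α : Ordinal.{0}) :
    ∀ i n m, w.Task i n m → w.tgt m ∉ removedSet (unitDeriv y) (Icc 0 1) α →
      ∀ t ∈ U i, t ∉ removedSet (unitDeriv x) (Icc 0 1) α := by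
  induction α using WellFoundedLT.induction with
  | ind α ih =>
  intro i n m ht hα t htU htα
  have hq := (mem_discontinuitySet_iff hyd (hw.target i n m ht).1).2 (hw.target i n m ht).2
  obtain ⟨β, hβα, hβ1, -, k, hk⟩ := exists_stage hyj hq hα
  have huniq : ∀ s ∈ U i, s ∈ removedSet (unitDeriv x) (Icc 0 1) β → s = w.src n := by
    intro s hsU hs
    by_contra hsn
    obtain ⟨j, hsj, hj | ⟨n', m', ht', hm'⟩⟩ :=
      hw.cover i n m ht k ⟨⟨removedSet_subset _ _ _ hs, hsU⟩, hsn⟩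
    · exact hj.notMem_discontinuitySet (hU j) hsj
        (removedSet_subset_discontinuitySet _ _ hβ1 hs)
    · exact ih β hβα j n' m' ht' (hk _ hm') s hsj hs
  have htβ : t ∈ removedSet (unitDeriv x) (Icc 0 1) (Order.succ β) :=
    removedSet_antitone _ _ (Order.succ_le_of_lt hβα) htα
  obtain ⟨δ, hδ, hball⟩ := Metric.isOpen_iff.1 (hU i) t htU
  obtain ⟨s, hs, hst, hsδ⟩ := exists_near_of_mem_removedSet_succ htβ hδ
  exact hst ((huniq s (hball hsδ) hs).trans
    (huniq t htU (removedSet_antitone _ _ hβα.le htα)).symm)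

theorem Coherent.removedSet_eq_empty (hw : w.Coherent U x y) (hU : ∀ j, IsOpen (U j))
    (hyd : DifferentiableOn ℝ (extendToReal y) (Icc 0 1))
    (hyj : HasIsolatedJumps (unitDeriv y) (Icc 0 1)) {α : Ordinal.{0}} (hα : 1 ≤ α) {T : Set ℝ}
    (hT : ∀ q ∈ T, q ∉ removedSet (unitDeriv y) (Icc 0 1) α)
    (hcov : Icc 0 1 ⊆ region U x w T) :
    removedSet (unitDeriv x) (Icc 0 1) α = ∅ := by
  refine eq_empty_iff_forall_notMem.2 fun t ht => ?_
  obtain ⟨j, htj, hj | ⟨n, m, htask, hm⟩⟩ := hcov (removedSet_subset _ _ _ ht)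
  · exact hj.notMem_discontinuitySet (hU j) htj (removedSet_subset_discontinuitySet _ _ hα ht)
  · exact hw.notMem_removedSet hU hyd hyj α j n m htask (hT _ hm) t htj ht

theorem Coherent.mem_SV {J : Set ℝ} (hw : w.Coherent U x y) (hU : ∀ j, IsOpen (U j))
    (hy : y ∈ SV J) (hcov : Icc 0 1 ⊆ region U x w univ) (hxJ : ∀ t, x t ∈ J)
    (hxL : ∃ C : ℕ, ∀ s t, |x s - x t| ≤ C * |(s : ℝ) - t|) : x ∈ SV J := by
  obtain ⟨α, -, hα⟩ := exists_removedSet_eq_empty_of_mem_SV hy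
  obtain ⟨-, hyd, -, hyj⟩ := mem_SV_iff.1 hy
  have key : ∀ t ∈ Icc (0 : ℝ) 1, (∃ i n m, w.Task i n m ∧ w.src n = t) ∨
      ∃ j, t ∈ U j ∧ HasUniformDerivOn x (w.localDeriv j) (U j) := by
    intro t ht
    obtain ⟨j, htj, hj | ⟨n, m, htask, -⟩⟩ := hcov ht
    · exact .inr ⟨j, htj, hj⟩
    · exact hw.isSource_or_hasUniformDerivOn hyd hyj α j n m htask (by simp [hα]) t ht htj
  have hsrc : ∀ t ∈ discontinuitySet (unitDeriv x) (Icc 0 1),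
      ∃ i n m, w.Task i n m ∧ w.src n = t := fun t ht =>
    (key t ht.1).resolve_right fun ⟨j, htj, hj⟩ => hj.notMem_discontinuitySet (hU j) htj ht
  have hder : ∀ i n m, w.Task i n m → unitDeriv x (w.src n) = w.srcDeriv n :=
    fun i n m h => (hw.source i n m h).unitDeriv_eq
  refine mem_SV_iff.2 ⟨hxJ, fun t ht => ?_, hxL, fun p hp => ?_⟩
  · rcases key t ht with ⟨i, n, m, htask, rfl⟩ | ⟨j, htj, hj⟩
    · exact (hw.source i n m htask).2.differentiableWithinAt
    · exact (hj.hasUnitDeriv (hU j) ht htj).2.differentiableWithinAt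
  · rcases key p hp with ⟨i, n, m, htask, rfl⟩ | ⟨j, hpj, hj⟩
    · obtain ⟨l, hl⟩ := hw.isolated i n m htask
      refine ⟨1 / ((l : ℝ) + 1), by positivity, fun z hz hzp hzl => ?_⟩
      obtain ⟨i', n', m', ht', rfl⟩ := hsrc z hz
      rw [hder _ _ _ ht', hder _ _ _ htask]
      exact hl i' n' m' ht' hzp hzl
    · obtain ⟨ε, hε, hball⟩ := Metric.isOpen_iff.1 (hU j) p hpj
      exact ⟨ε, hε, fun z hz _ hzp =>
        absurd hz (hj.notMem_discontinuitySet (hU j) (hball hzp))⟩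

end RankWitness

/-! ### Existence of coherent witnesses -/

namespace RankWitness
variable {U : ℕ → Set ℝ} {x y : C(unitInterval, ℝ)}

/-- `b` outlasts all points of `V` other than `a`: these leave the `x`-sequence of removed sets
strictly before `b` leaves the `y`-sequence. -/
def Dominates (x y : C(unitInterval, ℝ)) (V : Set ℝ) (a b : ℝ) : Prop :=
  ∃ γ : Ordinal.{0}, 1 ≤ γ ∧ b ∈ removedSet (unitDeriv y) (Icc 0 1) γ ∧
    ∀ t ∈ V, t ∈ removedSet (unitDeriv x) (Icc 0 1) γ → t = a

/-- A discontinuity point of `x'` isolated at stage `γ` is dominated, near it, by every point of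
stage `γ` of the `y`-sequence. -/
theorem exists_dominates (hU : TopologicalSpace.IsTopologicalBasis (range U))
    (hxj : HasIsolatedJumps (unitDeriv x) (Icc 0 1)) {γ : Ordinal.{0}} (hγ : 1 ≤ γ) {t b : ℝ}
    (ht : t ∈ removedSet (unitDeriv x) (Icc 0 1) γ)
    (ht' : t ∉ removedSet (unitDeriv x) (Icc 0 1) (Order.succ γ))
    (hb : b ∈ removedSet (unitDeriv y) (Icc 0 1) γ) :
    ∃ j, t ∈ U j ∧ Dominates x y (U j) t b := by
  obtain ⟨δ, hδ, H⟩ := hxj.eq_of_near hγ ht ht'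
  obtain ⟨_, ⟨j, rfl⟩, htj, hj⟩ :=
    hU.exists_subset_of_mem_open (Metric.mem_ball_self hδ) Metric.isOpen_ball
  exact ⟨j, htj, γ, hγ, hb, fun s hs hs' => H s hs' (hj hs)⟩

/-- The witness recording all true domination claims between the discontinuity points of `x'` and
of `y'`. Its coverage reaches every point whose rank is exceeded by points of `T`. -/
theorem exists_coherent (hU : TopologicalSpace.IsTopologicalBasis (range U))
    (hxd : DifferentiableOn ℝ (extendToReal x) (Icc 0 1))
    (hxj : HasIsolatedJumps (unitDeriv x) (Icc 0 1))
    (hyd : DifferentiableOn ℝ (extendToReal y) (Icc 0 1))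
    (hyj : HasIsolatedJumps (unitDeriv y) (Icc 0 1))
    {α : Ordinal.{0}} (hα : removedSet (unitDeriv x) (Icc 0 1) α = ∅) :
    ∃ w : RankWitness, w.Coherent U x y ∧ ∀ T : Set ℝ,
      ∀ t ∈ Icc (0 : ℝ) 1, (∀ γ, 1 ≤ γ → t ∈ removedSet (unitDeriv x) (Icc 0 1) γ →
        ∃ b ∈ T, b ∈ removedSet (unitDeriv y) (Icc 0 1) γ) → t ∈ region U x w T := by
  classical
  set Dx := discontinuitySet (unitDeriv x) (Icc 0 1)
  set Dy := discontinuitySet (unitDeriv y) (Icc 0 1)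
  obtain ⟨a, ha⟩ := countable_iff_exists_subset_range.1 hxj.countable
  obtain ⟨b, hb⟩ := countable_iff_exists_subset_range.1 hyj.countable
  have hDxcl : IsClosed Dx := hxj.isClosed_discontinuitySet subset_rfl isClosed_Icc
  let g : ℕ → C(unitInterval, ℝ) := fun j =>
    if h : ∃ g, HasUniformDerivOn x g (U j) then h.choose else 0
  have hg : ∀ j, (∃ g, HasUniformDerivOn x g (U j)) → HasUniformDerivOn x (g j) (U j) := by
    intro j h
    simpa only [g, dif_pos h] using h.choose_spec
  let w : RankWitness :=
    (fun k => decide (a k.2.1 ∈ Dx ∧ Dominates x y (U k.1) (a k.2.1) (b k.2.2)), a,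
      fun n => unitDeriv x (a n), b, fun m => unitDeriv y (b m), g)
  have hTask : ∀ i n m, w.Task i n m ↔ a n ∈ Dx ∧ Dominates x y (U i) (a n) (b m) :=
    fun i n m => decide_eq_true_iff
  have hDom : ∀ {V : Set ℝ} {p q : ℝ}, Dominates x y V p q → q ∈ Dy := by
    rintro V p q ⟨γ, hγ, hq, -⟩
    exact removedSet_subset_discontinuitySet _ _ hγ hq
  have hreg : ∀ T : Set ℝ,
      ∀ t ∈ Icc (0 : ℝ) 1, (∀ γ, 1 ≤ γ → t ∈ removedSet (unitDeriv x) (Icc 0 1) γ →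
        ∃ b ∈ T, b ∈ removedSet (unitDeriv y) (Icc 0 1) γ) → t ∈ region U x w T := by
    intro T t ht hT
    have htα : t ∉ removedSet (unitDeriv x) (Icc 0 1) α := by
      rw [hα]
      exact notMem_empty t
    by_cases htD : t ∈ Dx
    · obtain ⟨γ, -, hγ, hγ'⟩ := exists_mem_removedSet_notMem_succ ht htα
      have h1 : 1 ≤ γ := by
        rw [Order.one_le_iff_pos, pos_iff_ne_zero]
        rintro rfl
        rw [removedSet_succ, removedSet_zero] at hγ'
        exact hγ' htD
      obtain ⟨q, hqT, hq⟩ := hT γ h1 hγ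
      obtain ⟨j, htj, hj⟩ := exists_dominates hU hxj h1 hγ hγ' hq
      obtain ⟨n, rfl⟩ := ha htD
      obtain ⟨m, rfl⟩ := hb (hDom hj)
      exact ⟨j, htj, .inr ⟨n, m, (hTask _ _ _).2 ⟨htD, hj⟩, hqT⟩⟩
    · obtain ⟨δ, hδ, h, hh⟩ := exists_hasUniformDerivOn hxd hDxcl htD
      obtain ⟨_, ⟨j, rfl⟩, htj, hj⟩ :=
        hU.exists_subset_of_mem_open (Metric.mem_ball_self hδ) Metric.isOpen_ball
      refine ⟨j, htj, .inl (hg j ⟨h, fun k => ?_⟩)⟩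
      obtain ⟨l, hl⟩ := hh k
      exact ⟨l, fun s hs r hr hsU hrU => hl s hs r hr (hj hsU) (hj hrU)⟩
  refine ⟨w, ⟨fun i n m h => ?_, fun i n m h => ?_, fun i n m h => ?_, fun i n m h k => ?_⟩, hreg⟩
  · have hq : b m ∈ Dy := hDom ((hTask _ _ _).1 h).2
    have hder := hasUnitDeriv_unitDeriv hq.1 (hyd _ hq.1)
    exact ⟨hder, (mem_discontinuitySet_iff hyd hder).1 hq⟩
  · have hp : a n ∈ Dx := ((hTask _ _ _).1 h).1
    exact hasUnitDeriv_unitDeriv hp.1 (hxd _ hp.1)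
  · have hp : a n ∈ Dx := ((hTask _ _ _).1 h).1
    obtain ⟨ε, hε, H⟩ := hxj (a n) hp.1
    obtain ⟨l, hl⟩ := exists_nat_one_div_lt hε
    exact ⟨l, fun i' n' m' h' hne hlt =>
      hl.le.trans (H (a n') ((hTask _ _ _).1 h').1 hne (hlt.trans hl))⟩
  · rintro t ⟨⟨ht, htU⟩, htn⟩
    obtain ⟨γ, hγ, hbγ, H⟩ := ((hTask _ _ _).1 h).2
    refine hreg _ t ht fun β hβ htβ => ?_
    -- `t` leaves before stage `γ`, so `b m` survives the stage after `β`.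
    have hlt : β < γ := by
      by_contra hle
      exact htn (H t htU (removedSet_antitone _ _ (not_lt.1 hle) htβ))
    obtain ⟨r, hr, hrb, hrk⟩ := exists_near_of_mem_removedSet_succ
      (removedSet_antitone _ _ (Order.succ_le_of_lt hlt) hbγ)
      (show (0 : ℝ) < 1 / ((k : ℝ) + 1) by positivity)
    exact ⟨r, ⟨hrb, hrk⟩, hr⟩

/-- For `y ∈ SV`, membership of `x` in `SV` with rank at most that of `y` is witnessed. -/
theorem le_iff_exists (hU : TopologicalSpace.IsTopologicalBasis (range U)) {J : Set ℝ}
    (hy : y ∈ SV J) :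
    (x ∈ SV J ∧ solvableRank x ≤ solvableRank y) ↔
      (∀ t, x t ∈ J) ∧ (∃ C : ℕ, ∀ s t, |x s - x t| ≤ C * |(s : ℝ) - t|) ∧
        ∃ w : RankWitness, w.Coherent U x y ∧ Icc 0 1 ⊆ region U x w univ := by
  have hUo : ∀ j, IsOpen (U j) := fun j => hU.isOpen ⟨j, rfl⟩
  have hy' := (solvableRank_le_iff hy).1 le_rfl
  obtain ⟨-, hyd, -, hyj⟩ := mem_SV_iff.1 hy
  constructor
  · rintro ⟨hx, hle⟩
    obtain ⟨hxJ, hxd, hxL, hxj⟩ := mem_SV_iff.1 hx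
    obtain ⟨w, hw, hreg⟩ := exists_coherent hU hxd hxj hyd hyj
      ((solvableRank_le_iff hx).1 le_rfl)
    refine ⟨hxJ, hxL, w, hw, fun t ht => hreg univ t ht fun γ _ hγ => ?_⟩
    have hne : ¬ solvableRank y ≤ γ := fun h =>
      notMem_empty t ((solvableRank_le_iff hx).1 (hle.trans h) ▸ hγ)
    rw [solvableRank_le_iff hy] at hne
    obtain ⟨b, hb⟩ := nonempty_iff_ne_empty.2 hne
    exact ⟨b, mem_univ b, hb⟩
  · rintro ⟨hxJ, hxL, w, hw, hcov⟩
    have hx := hw.mem_SV hUo hy hcov hxJ hxL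
    refine ⟨hx, (solvableRank_le_iff hx).2 ?_⟩
    exact hw.removedSet_eq_empty hUo hyd hyj (one_le_of_removedSet_eq_empty hy')
      (fun q _ => by simp [hy']) hcov

/-- Between members of `SV`, the strict inequality of ranks is witnessed. -/
theorem lt_iff_exists (hU : TopologicalSpace.IsTopologicalBasis (range U)) {J : Set ℝ}
    (hx : x ∈ SV J) (hy : y ∈ SV J) :
    solvableRank x < solvableRank y ↔
      ∃ (w : RankWitness) (q v : ℝ), w.Coherent U x y ∧ HasUnitDeriv y q v ∧
        ¬ HasStrictUnitDeriv y q v ∧ ∀ k, Icc 0 1 ⊆ region U x w (punctured q k) := by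
  have hUo : ∀ j, IsOpen (U j) := fun j => hU.isOpen ⟨j, rfl⟩
  have hx' := (solvableRank_le_iff hx).1 le_rfl
  have hy' := (solvableRank_le_iff hy).1 le_rfl
  obtain ⟨-, hyd, -, hyj⟩ := mem_SV_iff.1 hy
  constructor
  · intro hlt
    obtain ⟨-, hxd, -, hxj⟩ := mem_SV_iff.1 hx
    obtain ⟨w, hw, hreg⟩ := exists_coherent hU hxd hxj hyd hyj hx'
    have hne := not_le.2 hlt
    rw [solvableRank_le_iff hy] at hne
    obtain ⟨q, hq⟩ := nonempty_iff_ne_empty.2 hne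
    have hqD := removedSet_subset_discontinuitySet _ _ (one_le_of_removedSet_eq_empty hx') hq
    have hder := hasUnitDeriv_unitDeriv hqD.1 (hyd _ hqD.1)
    refine ⟨w, q, _, hw, hder, (mem_discontinuitySet_iff hyd hder).1 hqD,
      fun k t ht => hreg _ t ht fun γ _ hγ => ?_⟩
    have hγx : γ < solvableRank x := by
      by_contra h
      exact notMem_empty t ((solvableRank_le_iff hx).1 (not_lt.1 h) ▸ hγ)
    obtain ⟨r, hr, hrq, hrk⟩ := exists_near_of_mem_removedSet_succ
      (removedSet_antitone _ _ (Order.succ_le_of_lt hγx) hq)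
      (show (0 : ℝ) < 1 / ((k : ℝ) + 1) by positivity)
    exact ⟨r, ⟨hrq, hrk⟩, hr⟩
  · rintro ⟨w, q, v, hw, hder, hq, hcov⟩
    obtain ⟨β, hβ, hβ1, hqβ, k, hk⟩ := exists_stage hyj
      ((mem_discontinuitySet_iff hyd hder).2 hq) (α := solvableRank y) (by simp [hy'])
    exact ((solvableRank_le_iff hx).2
      (hw.removedSet_eq_empty hUo hyd hyj hβ1 hk (hcov k))).trans_lt hβ

end RankWitness

/-! ### Measurability of the conditions on derivatives -/

theorem hasUnitDeriv_iff {y : C(unitInterval, ℝ)} {c v : ℝ} :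
    HasUnitDeriv y c v ↔ c ∈ Icc (0 : ℝ) 1 ∧ ∀ k : ℕ, ∃ l : ℕ, ∀ t ∈ Icc (0 : ℝ) 1,
      |t - c| < 1 / ((l : ℝ) + 1) →
        |extendToReal y t - extendToReal y c - v * (t - c)| ≤ 1 / ((k : ℝ) + 1) * |t - c| := by
  refine and_congr_right fun _ => ?_
  rw [hasDerivWithinAt_iff_isLittleO, Asymptotics.isLittleO_iff]
  simp only [Real.norm_eq_abs, smul_eq_mul, mul_comm _ v]
  constructor
  · intro h k
    obtain ⟨δ, hδ, H⟩ := Metric.mem_nhdsWithin_iff.1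
      (h (show (0 : ℝ) < 1 / ((k : ℝ) + 1) by positivity))
    obtain ⟨l, hl⟩ := exists_nat_one_div_lt hδ
    exact ⟨l, fun t ht htc => H ⟨htc.trans hl, ht⟩⟩
  · intro h ε hε
    obtain ⟨k, hk⟩ := exists_nat_one_div_lt hε
    obtain ⟨l, hl⟩ := h k
    refine Metric.mem_nhdsWithin_iff.2 ⟨1 / ((l : ℝ) + 1), by positivity, fun t ht => ?_⟩
    exact (hl t ht.2 ht.1).trans (mul_le_mul_of_nonneg_right hk.le (abs_nonneg _))

theorem isClosed_setOf_forall {X : Type*} {ι : Sort*} [TopologicalSpace X] {p : ι → X → Prop}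
    (h : ∀ i, IsClosed {x | p i x}) : IsClosed {x | ∀ i, p i x} := by
  rw [show {x | ∀ i, p i x} = ⋂ i, {x | p i x} by ext; simp]
  exact isClosed_iInter h

theorem Continuous.extendToReal {X : Type*} [TopologicalSpace X] {F : X → C(unitInterval, ℝ)}
    {c : X → ℝ} (hF : Continuous F) (hc : Continuous c) :
    Continuous fun ω => extendToReal (F ω) (c ω) := by
  have : Continuous fun ω => F ω (projIcc 0 1 (zero_le_one' ℝ) (c ω)) :=
    hF.eval (continuous_projIcc.comp hc)
  exact this

/-- Coverage of a compact set by a measurably varying choice of open sets is a measurable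
condition, since it only involves finite subcovers. -/
theorem measurable_subset_setOf_exists {Ω : Type*} [MeasurableSpace Ω] {U : ℕ → Set ℝ} (hU : ∀ j, IsOpen (U j)) {K : Set ℝ}
    (hK : IsCompact K) {P : Ω → ℕ → Prop} (hP : ∀ j, Measurable fun ω => P ω j) :
    Measurable fun ω => K ⊆ {z | ∃ j, z ∈ U j ∧ P ω j} := by
  have : ∀ ω, K ⊆ {z | ∃ j, z ∈ U j ∧ P ω j} ↔
      ∃ t : Finset ℕ, (∀ j ∈ t, P ω j) ∧ K ⊆ ⋃ j ∈ t, U j := by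
    intro ω
    constructor
    · intro h
      obtain ⟨t, ht⟩ := hK.elim_finite_subcover (fun j : {j // P ω j} => U j) (fun j => hU j)
        fun z hz => by
          obtain ⟨j, hj, hPj⟩ := h hz
          exact mem_iUnion.2 ⟨⟨j, hPj⟩, hj⟩
      refine ⟨t.map (Function.Embedding.subtype _), fun j hj => ?_, fun z hz => ?_⟩
      · obtain ⟨a, -, rfl⟩ := Finset.mem_map.1 hj
        exact a.2
      · obtain ⟨a, ha, hza⟩ := mem_iUnion₂.1 (ht hz)
        exact mem_iUnion₂.2 ⟨a, Finset.mem_map_of_mem _ ha, hza⟩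
    · rintro ⟨t, ht, hKt⟩ z hz
      obtain ⟨j, hj, hzj⟩ := mem_iUnion₂.1 (hKt hz)
      exact ⟨j, hzj, ht j hj⟩
  simp only [this]
  exact Measurable.exists fun t => Measurable.and
    (Measurable.forall fun j => measurable_const.imp (hP j)) measurable_const

section Measurability

variable [MeasurableSpace C(unitInterval, ℝ)] [BorelSpace C(unitInterval, ℝ)]
variable {Ω : Type*} [MeasurableSpace Ω] {F G : Ω → C(unitInterval, ℝ)} {c v : Ω → ℝ}

theorem Measurable.hasUnitDeriv (hF : Measurable F) (hc : Measurable c) (hv : Measurable v) :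
    Measurable fun ω => HasUnitDeriv (F ω) (c ω) (v ω) := by
  have key : Measurable fun p : C(unitInterval, ℝ) × ℝ × ℝ => HasUnitDeriv p.1 p.2.1 p.2.2 := by
    simp only [hasUnitDeriv_iff]
    refine Measurable.and (measurableSet_setOfPred.1 ?_)
      (Measurable.forall fun k => Measurable.exists fun l => measurableSet_setOfPred.1 ?_)
    · exact measurableSet_Icc.preimage (measurable_fst.comp measurable_snd)
    · refine IsClosed.measurableSet (isClosed_setOf_forall fun t => isClosed_setOf_forall fun _ =>
        isClosed_imp (isOpen_lt (by fun_prop) (by fun_prop))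
          (isClosed_le ?_ (by fun_prop)))
      have h1 : Continuous fun p : C(unitInterval, ℝ) × ℝ × ℝ => extendToReal p.1 t :=
        continuous_fst.extendToReal continuous_const
      have h2 : Continuous fun p : C(unitInterval, ℝ) × ℝ × ℝ => extendToReal p.1 p.2.1 :=
        continuous_fst.extendToReal (by fun_prop)
      fun_prop
  exact key.comp (hF.prodMk (hc.prodMk hv))

theorem Measurable.hasStrictUnitDeriv (hF : Measurable F) (hc : Measurable c)
    (hv : Measurable v) : Measurable fun ω => HasStrictUnitDeriv (F ω) (c ω) (v ω) := by
  have key : Measurable fun p : C(unitInterval, ℝ) × ℝ × ℝ =>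
      HasStrictUnitDeriv p.1 p.2.1 p.2.2 := by
    refine Measurable.forall fun k => Measurable.exists fun l => measurableSet_setOfPred.1 ?_
    refine IsClosed.measurableSet (isClosed_setOf_forall fun s => isClosed_setOf_forall fun _ =>
      isClosed_setOf_forall fun t => isClosed_setOf_forall fun _ =>
        isClosed_imp (isOpen_lt (by fun_prop) (by fun_prop))
          (isClosed_imp (isOpen_lt (by fun_prop) (by fun_prop))
            (isClosed_le ?_ (by fun_prop))))
    have h1 : ∀ t, Continuous fun p : C(unitInterval, ℝ) × ℝ × ℝ => extendToReal p.1 t :=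
      fun t => continuous_fst.extendToReal continuous_const
    have h2 := h1 t
    have h3 := h1 s
    fun_prop
  exact key.comp (hF.prodMk (hc.prodMk hv))

theorem Measurable.hasUniformDerivOn (hF : Measurable F) (hG : Measurable G) (U : Set ℝ) :
    Measurable fun ω => HasUniformDerivOn (F ω) (G ω) U := by
  have key : Measurable fun p : C(unitInterval, ℝ) × C(unitInterval, ℝ) =>
      HasUniformDerivOn p.1 p.2 U := by
    refine Measurable.forall fun k => Measurable.exists fun l => measurableSet_setOfPred.1 ?_
    refine IsClosed.measurableSet (isClosed_setOf_forall fun s => isClosed_setOf_forall fun _ =>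
      isClosed_setOf_forall fun t => isClosed_setOf_forall fun _ => isClosed_setOf_forall fun _ =>
        isClosed_setOf_forall fun _ => isClosed_setOf_forall fun _ =>
            isClosed_le ?_ (by fun_prop))
    have h1 : ∀ t, Continuous fun p : C(unitInterval, ℝ) × C(unitInterval, ℝ) =>
        extendToReal p.1 t := fun t => continuous_fst.extendToReal continuous_const
    have h2 := h1 t
    have h3 := h1 s
    have h4 : Continuous fun p : C(unitInterval, ℝ) × C(unitInterval, ℝ) =>
        extendToReal p.2 t := continuous_snd.extendToReal continuous_const
    fun_prop
  exact key.comp (hF.prodMk hG)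

end Measurability

/-! ### Measurability of coherence -/

namespace RankWitness

theorem _root_.polishSpace_prod {X Y : Type*} [TopologicalSpace X] [TopologicalSpace Y]
    (hX : PolishSpace X) (hY : PolishSpace Y) : PolishSpace (X × Y) :=
  @PolishSpace.mk _ _ inferInstance inferInstance

instance : PolishSpace RankWitness :=
  have hR : PolishSpace (ℕ → ℝ) := inferInstance
  polishSpace_prod (@PolishSpace.mk _ _ inferInstance inferInstance) <| polishSpace_prod hR <|
    polishSpace_prod hR <| polishSpace_prod hR <| polishSpace_prod hR <|
      @PolishSpace.mk _ _ inferInstance inferInstance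

instance [MeasurableSpace C(unitInterval, ℝ)] [BorelSpace C(unitInterval, ℝ)] :
    BorelSpace RankWitness := by
  have h1 : BorelSpace (ℕ × ℕ × ℕ → Bool) := inferInstance
  have h2 : BorelSpace (ℕ → C(unitInterval, ℝ)) := inferInstance
  have h3 : BorelSpace ((ℕ → ℝ) × (ℕ → C(unitInterval, ℝ))) := inferInstance
  have h4 : BorelSpace ((ℕ → ℝ) × (ℕ → ℝ) × (ℕ → C(unitInterval, ℝ))) := inferInstance
  have h5 : BorelSpace ((ℕ → ℝ) × (ℕ → ℝ) × (ℕ → ℝ) × (ℕ → C(unitInterval, ℝ))) :=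
    inferInstance
  exact inferInstanceAs (BorelSpace ((ℕ × ℕ × ℕ → Bool) × (ℕ → ℝ) × (ℕ → ℝ) × (ℕ → ℝ) ×
    (ℕ → ℝ) × (ℕ → C(unitInterval, ℝ))))

theorem measurable_mem_punctured {Ω : Type*} [MeasurableSpace Ω] {q r : Ω → ℝ} (hq : Measurable q) (hr : Measurable r) (k : ℕ) :
    Measurable fun ω => r ω ∈ punctured (q ω) k :=
  (measurableSet_setOfPred.1 (measurableSet_eq_fun hr hq)).not.and
    (measurableSet_setOfPred.1 (measurableSet_lt (hr.sub hq).abs measurable_const))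

/-- The cover condition expressed through countably many compact sets. -/
theorem cover_iff {U : ℕ → Set ℝ} (hU : TopologicalSpace.IsTopologicalBasis (range U)) {i : ℕ} {a : ℝ}
    {S : Set ℝ} : (Icc 0 1 ∩ U i) \ {a} ⊆ S ↔
      ∀ j, closure (U j) ⊆ U i → a ∉ closure (U j) → Icc 0 1 ∩ closure (U j) ⊆ S := by
  constructor
  · rintro h j hj ha t ⟨ht, htj⟩
    exact h ⟨⟨ht, hj htj⟩, fun hta => ha (hta ▸ htj)⟩
  · rintro h t ⟨⟨ht, hti⟩, hta⟩
    obtain ⟨_, ⟨j, rfl⟩, htj, hj⟩ := hU.exists_closure_subset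
      (((hU.isOpen ⟨i, rfl⟩).inter isOpen_compl_singleton).mem_nhds ⟨hti, hta⟩)
    exact h j (hj.trans inter_subset_left) (fun ha => (hj ha).2 rfl) ⟨ht, subset_closure htj⟩

section Measurability

variable [MeasurableSpace C(unitInterval, ℝ)]
variable {Ω : Type*} [MeasurableSpace Ω] {X Y : Ω → C(unitInterval, ℝ)} {W : Ω → RankWitness}
  {U : ℕ → Set ℝ}

theorem measurable_task (hW : Measurable W) (i n m : ℕ) :
    Measurable fun ω => (W ω).Task i n m := by
  have : Measurable fun ω => (W ω).1 (i, n, m) := by fun_prop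
  exact measurableSet_setOfPred.1 (this (measurableSet_singleton true))

theorem measurable_src (hW : Measurable W) (n : ℕ) : Measurable fun ω => (W ω).src n := by
  unfold src
  fun_prop

theorem measurable_srcDeriv (hW : Measurable W) (n : ℕ) :
    Measurable fun ω => (W ω).srcDeriv n := by
  unfold srcDeriv
  fun_prop

theorem measurable_tgt (hW : Measurable W) (m : ℕ) : Measurable fun ω => (W ω).tgt m := by
  unfold tgt
  fun_prop

theorem measurable_tgtDeriv (hW : Measurable W) (m : ℕ) :
    Measurable fun ω => (W ω).tgtDeriv m := by
  unfold tgtDeriv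
  fun_prop

theorem measurable_localDeriv (hW : Measurable W) (j : ℕ) :
    Measurable fun ω => (W ω).localDeriv j := by
  unfold localDeriv
  fun_prop

variable [BorelSpace C(unitInterval, ℝ)]

theorem measurable_subset_region (hX : Measurable X) (hW : Measurable W)
    (hU : ∀ j, IsOpen (U j)) {T : Ω → Set ℝ} (hT : ∀ m, Measurable fun ω => (W ω).tgt m ∈ T ω)
    {K : Set ℝ} (hK : IsCompact K) : Measurable fun ω => K ⊆ region U (X ω) (W ω) (T ω) :=
  measurable_subset_setOf_exists hU hK fun j =>
    (hX.hasUniformDerivOn (measurable_localDeriv hW j) (U j)).or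
      (Measurable.exists fun n => Measurable.exists fun m => (measurable_task hW j n m).and (hT m))

theorem measurable_coherent (hU : TopologicalSpace.IsTopologicalBasis (range U))
    (hX : Measurable X) (hY : Measurable Y) (hW : Measurable W) :
    Measurable fun ω => (W ω).Coherent U (X ω) (Y ω) := by
  have hUo : ∀ j, IsOpen (U j) := fun j => hU.isOpen ⟨j, rfl⟩
  have hsrc := measurable_src hW
  have hsrcD := measurable_srcDeriv hW
  have htask := measurable_task hW
  have htgt := measurable_tgt hW
  have h1 : Measurable fun ω => ∀ i n m, (W ω).Task i n m →
      HasUnitDeriv (Y ω) ((W ω).tgt m) ((W ω).tgtDeriv m) ∧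
        ¬ HasStrictUnitDeriv (Y ω) ((W ω).tgt m) ((W ω).tgtDeriv m) :=
    .forall fun i => .forall fun n => .forall fun m => (htask i n m).imp
      ((hY.hasUnitDeriv (htgt m) (measurable_tgtDeriv hW m)).and
        (hY.hasStrictUnitDeriv (htgt m) (measurable_tgtDeriv hW m)).not)
  have h2 : Measurable fun ω => ∀ i n m, (W ω).Task i n m →
      HasUnitDeriv (X ω) ((W ω).src n) ((W ω).srcDeriv n) :=
    .forall fun i => .forall fun n => .forall fun m => (htask i n m).imp
      (hX.hasUnitDeriv (hsrc n) (hsrcD n))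
  have h3 : Measurable fun ω => ∀ i n m, (W ω).Task i n m → ∃ l : ℕ, ∀ i' n' m',
      (W ω).Task i' n' m' → (W ω).src n' ≠ (W ω).src n →
        |(W ω).src n' - (W ω).src n| < 1 / ((l : ℝ) + 1) →
          1 / ((l : ℝ) + 1) ≤ |(W ω).srcDeriv n' - (W ω).srcDeriv n| := by
    refine .forall fun i => .forall fun n => .forall fun m => (htask i n m).imp <|
      .exists fun l => .forall fun i' => .forall fun n' => .forall fun m' =>
        (htask i' n' m').imp <| .imp ?_ <| .imp ?_ ?_
    · exact (measurableSet_setOfPred.1 (measurableSet_eq_fun (hsrc n') (hsrc n))).not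
    · exact measurableSet_setOfPred.1
        (measurableSet_lt ((hsrc n').sub (hsrc n)).abs measurable_const)
    · exact measurableSet_setOfPred.1
        (measurableSet_le measurable_const ((hsrcD n').sub (hsrcD n)).abs)
  have h4 : Measurable fun ω => ∀ i n m, (W ω).Task i n m → ∀ k,
      (Icc 0 1 ∩ U i) \ {(W ω).src n} ⊆
        region U (X ω) (W ω) (punctured ((W ω).tgt m) k) := by
    simp only [cover_iff hU]
    refine .forall fun i => .forall fun n => .forall fun m => (htask i n m).imp <|
      .forall fun k => .forall fun j => measurable_const.imp <| .imp ?_ ?_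
    · exact measurableSet_setOfPred.1 (isClosed_closure.measurableSet.compl.preimage (hsrc n))
    · exact measurable_subset_region hX hW hUo
        (fun m' => measurable_mem_punctured (htgt m) (htgt m') k)
        (isCompact_Icc.inter_right isClosed_closure)
  have : ∀ ω, (W ω).Coherent U (X ω) (Y ω) ↔ _ :=
    fun ω => ⟨fun h => (⟨h.target, h.source, h.isolated, h.cover⟩ : _ ∧ _ ∧ _ ∧ _),
      fun h => ⟨h.1, h.2.1, h.2.2.1, h.2.2.2⟩⟩
  simp only [this]
  exact h1.and (h2.and (h3.and h4))

end Measurability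

end RankWitness

/-! ### Complexity -/

theorem MeasureTheory.analyticSet_setOf_exists {X W : Type*} [TopologicalSpace X] [PolishSpace X]
    [MeasurableSpace X] [BorelSpace X] [TopologicalSpace W] [PolishSpace W] [MeasurableSpace W]
    [BorelSpace W] {p : X → W → Prop} (hp : Measurable fun z : X × W => p z.1 z.2) :
    MeasureTheory.AnalyticSet {x | ∃ w, p x w} := by
  have := (measurableSet_setOfPred.2 hp).analyticSet.image_of_continuous continuous_fst
  convert this using 1
  ext x
  simp

theorem MeasureTheory.AnalyticSet.union' {X : Type*} [TopologicalSpace X] {s t : Set X}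
    (hs : MeasureTheory.AnalyticSet s) (ht : MeasureTheory.AnalyticSet t) :
    MeasureTheory.AnalyticSet (s ∪ t) := by
  rw [union_eq_iUnion]
  exact .iUnion fun b => by cases b <;> assumption

section

variable [MeasurableSpace C(unitInterval, ℝ)] [BorelSpace C(unitInterval, ℝ)]

theorem measurable_forall_mem {J : Set ℝ} (hJ : IsClosed J) :
    Measurable fun y : C(unitInterval, ℝ) => ∀ t, y t ∈ J :=
  measurableSet_setOfPred.1 (isClosed_setOf_forall fun t =>
    hJ.preimage (continuous_eval_const t)).measurableSet

theorem measurable_exists_lipschitz :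
    Measurable fun y : C(unitInterval, ℝ) =>
      ∃ C : ℕ, ∀ s t, |y s - y t| ≤ C * |(s : ℝ) - t| := by
  refine .exists fun C => measurableSet_setOfPred.1 (isClosed_setOf_forall fun s =>
    isClosed_setOf_forall fun t => isClosed_le ?_ continuous_const).measurableSet
  fun_prop

/-- Differentiability at a given point is a Borel condition: the derivative is unique, so the
projection forgetting its value is injective. -/
theorem measurable_exists_hasUnitDeriv :
    Measurable fun z : C(unitInterval, ℝ) × ℝ => ∃ v, HasUnitDeriv z.1 z.2 v := by
  have h : MeasurableSet {z : (C(unitInterval, ℝ) × ℝ) × ℝ | HasUnitDeriv z.1.1 z.1.2 z.2} :=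
    measurableSet_setOfPred.2 (Measurable.hasUnitDeriv (by fun_prop) (by fun_prop) (by fun_prop))
  have h' := h.image_of_measurable_injOn measurable_fst (by
    rintro ⟨z, v⟩ hv ⟨_, v'⟩ hv' rfl
    exact Prod.ext rfl (HasUnitDeriv.unitDeriv_eq hv ▸ HasUnitDeriv.unitDeriv_eq hv'))
  refine measurableSet_setOfPred.1 ?_
  convert h' using 1
  ext z
  simp

end

/-- For `d = (p, v, z, u)`: the `z n ≠ p` are jumps of `y'` with derivatives `u n`, and the points
`(z n, u n)` converge to `(p, v)`, where `v` is the derivative at `p`. -/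
def HasClusteringJumps (y : C(unitInterval, ℝ)) (d : ℝ × ℝ × (ℕ → ℝ) × (ℕ → ℝ)) : Prop :=
  HasUnitDeriv y d.1 d.2.1 ∧ ∀ n, HasUnitDeriv y (d.2.2.1 n) (d.2.2.2 n) ∧
    ¬ HasStrictUnitDeriv y (d.2.2.1 n) (d.2.2.2 n) ∧ d.2.2.1 n ≠ d.1 ∧
      |d.2.2.1 n - d.1| < 1 / ((n : ℝ) + 1) ∧ |d.2.2.2 n - d.2.1| < 1 / ((n : ℝ) + 1)

theorem hasIsolatedJumps_iff_not_exists {y : C(unitInterval, ℝ)}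
    (hy : DifferentiableOn ℝ (extendToReal y) (Icc 0 1)) :
    HasIsolatedJumps (unitDeriv y) (Icc 0 1) ↔ ¬ ∃ d, HasClusteringJumps y d := by
  constructor
  · rintro h ⟨⟨p, v, z, u⟩, hp, hz⟩
    obtain ⟨ε, hε, H⟩ := h p hp.1
    obtain ⟨n, hn⟩ := exists_nat_one_div_lt hε
    obtain ⟨h1, h2, h3, h4, h5⟩ := hz n
    have := H (z n) ((mem_discontinuitySet_iff hy h1).2 h2) h3 (h4.trans hn)
    rw [h1.unitDeriv_eq, hp.unitDeriv_eq] at this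
    exact absurd (h5.trans hn) (not_lt.2 this)
  · intro h p hp
    by_contra! hcon
    choose z hz hzp hzn hfz using fun n : ℕ => hcon (1 / ((n : ℝ) + 1)) (by positivity)
    have hder := fun n => hasUnitDeriv_unitDeriv (hz n).1 (hy _ (hz n).1)
    exact h ⟨⟨p, _, z, _⟩, hasUnitDeriv_unitDeriv hp (hy p hp), fun n =>
      ⟨hder n, (mem_discontinuitySet_iff hy (hder n)).1 (hz n), hzp n, hzn n, hfz n⟩⟩

theorem isCoanalytic_SV {J : Set ℝ} (hJ : IsClosed J) : IsCoanalytic (SV J) := by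
  borelize C(unitInterval, ℝ)
  have hcompl : (SV J)ᶜ = ({y | ¬ ∀ t, y t ∈ J} ∪
      {y | ¬ ∃ C : ℕ, ∀ s t : unitInterval, |y s - y t| ≤ C * |(s : ℝ) - t|}) ∪
      ({y | ∃ c, c ∈ Icc (0 : ℝ) 1 ∧ ¬ ∃ v, HasUnitDeriv y c v} ∪
      {y | ∃ d, HasClusteringJumps y d}) := by
    ext y
    rw [mem_compl_iff, mem_SV_iff]
    by_cases hy : DifferentiableOn ℝ (extendToReal y) (Icc 0 1)
    · have h1 : ¬ ∃ c, c ∈ Icc (0 : ℝ) 1 ∧ ¬ ∃ v, HasUnitDeriv y c v := by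
        rintro ⟨c, hc, h⟩
        exact h ⟨_, hasUnitDeriv_unitDeriv hc (hy c hc)⟩
      rw [hasIsolatedJumps_iff_not_exists hy]
      simp only [mem_union, mem_ofPred_eq, h1, hy]
      grind
    · have h1 : ∃ c, c ∈ Icc (0 : ℝ) 1 ∧ ¬ ∃ v, HasUnitDeriv y c v := by
        by_contra! h
        exact hy fun c hc => (h c hc).choose_spec.2.differentiableWithinAt
      simp only [mem_union, mem_ofPred_eq, h1, hy]
      grind
  unfold IsCoanalytic
  rw [hcompl]
  refine .union' (.union' ?_ ?_) (.union' ?_ ?_)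
  · exact (measurableSet_setOfPred.2 (measurable_forall_mem hJ).not).analyticSet
  · exact (measurableSet_setOfPred.2 measurable_exists_lipschitz.not).analyticSet
  · refine MeasureTheory.analyticSet_setOf_exists (.and ?_ measurable_exists_hasUnitDeriv.not)
    exact measurableSet_setOfPred.1 (measurableSet_Icc.preimage measurable_snd)
  · refine MeasureTheory.analyticSet_setOf_exists (.and ?_ (.forall fun n =>
      .and ?_ (.and (.not ?_) (.and (.not ?_) (.and ?_ ?_)))))
    · exact Measurable.hasUnitDeriv (by fun_prop) (by fun_prop) (by fun_prop)
    · exact Measurable.hasUnitDeriv (by fun_prop) (by fun_prop) (by fun_prop)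
    · exact Measurable.hasStrictUnitDeriv (by fun_prop) (by fun_prop) (by fun_prop)
    · exact measurableSet_setOfPred.1 (measurableSet_eq_fun (by fun_prop) (by fun_prop))
    · exact measurableSet_setOfPred.1 (measurableSet_lt (by fun_prop) (by fun_prop))
    · exact measurableSet_setOfPred.1 (measurableSet_lt (by fun_prop) (by fun_prop))

/-- The pairs `(x, y)` for which `x` is `J`-valued and Lipschitz and a coherent witness covers
`[0,1]`. -/
def leSet (J : Set ℝ) (U : ℕ → Set ℝ) : Set (C(unitInterval, ℝ) × C(unitInterval, ℝ)) :=
  {p | ∃ w : RankWitness,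
    (∀ t, p.1 t ∈ J) ∧ (∃ C : ℕ, ∀ s t, |p.1 s - p.1 t| ≤ C * |(s : ℝ) - t|) ∧
      w.Coherent U p.1 p.2 ∧ Icc 0 1 ⊆ RankWitness.region U p.1 w univ}

/-- The pairs `(x, y)` for which a coherent witness, comparing `y` to `x`, places all of `[0,1]`
below a single jump of `x'`. -/
def gtSet (U : ℕ → Set ℝ) : Set (C(unitInterval, ℝ) × C(unitInterval, ℝ)) :=
  {p | ∃ d : RankWitness × ℝ × ℝ, d.1.Coherent U p.2 p.1 ∧ HasUnitDeriv p.1 d.2.1 d.2.2 ∧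
    ¬ HasStrictUnitDeriv p.1 d.2.1 d.2.2 ∧
      ∀ k, Icc 0 1 ⊆ RankWitness.region U p.2 d.1 (RankWitness.punctured d.2.1 k)}

theorem analyticSet_leSet {J : Set ℝ} (hJ : IsClosed J) {U : ℕ → Set ℝ}
    (hU : TopologicalSpace.IsTopologicalBasis (range U)) :
    MeasureTheory.AnalyticSet (leSet J U) := by
  borelize C(unitInterval, ℝ)
  let Z := (C(unitInterval, ℝ) × C(unitInterval, ℝ)) × RankWitness
  have hx : Measurable fun z : Z => z.1.1 := measurable_fst.comp measurable_fst
  have hy : Measurable fun z : Z => z.1.2 := measurable_snd.comp measurable_fst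
  have hw : Measurable fun z : Z => z.2 := measurable_snd
  have h1 := (measurable_forall_mem hJ).comp hx
  have h2 := measurable_exists_lipschitz.comp hx
  have h3 := RankWitness.measurable_coherent hU hx hy hw
  have h4 := RankWitness.measurable_subset_region hx hw (fun j => hU.isOpen ⟨j, rfl⟩)
    (T := fun _ => univ) (fun _ => measurable_const) isCompact_Icc (K := Icc 0 1)
  exact MeasureTheory.analyticSet_setOf_exists (h1.and (h2.and (h3.and h4)))

theorem analyticSet_gtSet {U : ℕ → Set ℝ}
    (hU : TopologicalSpace.IsTopologicalBasis (range U)) :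
    MeasureTheory.AnalyticSet (gtSet U) := by
  borelize C(unitInterval, ℝ)
  have := polishSpace_prod (X := RankWitness) (Y := ℝ × ℝ) inferInstance inferInstance
  let Z := (C(unitInterval, ℝ) × C(unitInterval, ℝ)) × RankWitness × ℝ × ℝ
  have hx : Measurable fun z : Z => z.1.1 := measurable_fst.comp measurable_fst
  have hy : Measurable fun z : Z => z.1.2 := measurable_snd.comp measurable_fst
  have hw : Measurable fun z : Z => z.2.1 := measurable_fst.comp measurable_snd
  have hqv : Measurable fun z : Z => z.2.2 := measurable_snd.comp measurable_snd
  have hq : Measurable fun z : Z => z.2.2.1 := measurable_fst.comp hqv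
  have hv : Measurable fun z : Z => z.2.2.2 := measurable_snd.comp hqv
  have h1 := RankWitness.measurable_coherent hU hy hx hw
  have h2 := hx.hasUnitDeriv hq hv
  have h3 := (hx.hasStrictUnitDeriv hq hv).not
  have h4 := fun k => RankWitness.measurable_subset_region hy hw (fun j => hU.isOpen ⟨j, rfl⟩)
    (fun m => RankWitness.measurable_mem_punctured hq (RankWitness.measurable_tgt hw m) k)
    isCompact_Icc (K := Icc 0 1)
  exact MeasureTheory.analyticSet_setOf_exists (h1.and (h2.and (h3.and (.forall h4))))

theorem mainTheorem3 (J : Set ℝ) (hJ : IsClosed J) :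
    (∀ y ∈ SV J, ∃ α : Ordinal.{0}, α < Ordinal.omega 1 ∧
      removedSet (unitDeriv y) (Set.Icc 0 1) α = ∅) ∧
    IsPi11Norm (SV J) (fun y : SV J => solvableRank y) := by
  refine ⟨fun y hy => exists_removedSet_eq_empty_of_mem_SV hy, isCoanalytic_SV hJ, ?_⟩
  obtain ⟨U, hUr⟩ := (TopologicalSpace.countable_countableBasis ℝ).exists_eq_range
    (((TopologicalSpace.isBasis_countableBasis ℝ).exists_subset_of_mem_open (mem_univ 0)
      isOpen_univ).imp fun _ h => h.1)
  have hU : TopologicalSpace.IsTopologicalBasis (range U) :=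
    hUr ▸ TopologicalSpace.isBasis_countableBasis ℝ
  have hco : MeasureTheory.AnalyticSet (SV J)ᶜ := isCoanalytic_SV hJ
  -- For the second description, `|x| ≤ |y|` fails for `y ∈ SV` if `x ∉ SV` or `|y| < |x|`.
  refine ⟨leSet J U, (Prod.fst ⁻¹' (SV J)ᶜ ∪ gtSet U)ᶜ, analyticSet_leSet hJ hU, ?_,
    fun x y hy => ?_⟩
  · unfold IsCoanalytic
    rw [compl_compl]
    exact (hco.preimage continuous_fst).union' (analyticSet_gtSet hU)
  · simp only [exists_prop]
    constructor
    · rw [RankWitness.le_iff_exists hU hy]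
      exact ⟨fun ⟨h1, h2, w, h⟩ => ⟨w, h1, h2, h⟩, fun ⟨w, h1, h2, h⟩ => ⟨h1, h2, w, h⟩⟩
    · rw [mem_compl_iff, mem_union, mem_preimage, mem_compl_iff, not_or, not_not]
      refine and_congr_right fun hx => ?_
      rw [← not_lt, RankWitness.lt_iff_exists hU hy hx]
      exact not_congr ⟨fun ⟨w, q, v, h⟩ => ⟨⟨w, q, v⟩, h⟩, fun ⟨⟨w, q, v⟩, h⟩ => ⟨w, q, v, h⟩⟩
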